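/- **Setting.** Let $k$ be a field and let $\mathcal C$ be a small $k$-linear category; write ${}_y\mathcal C_x$ for the vector space of morphisms from $x$ to $y$. Assume that $\mathcal C$ is *Schurian*: every ${}_y\mathcal C_x$ has dimension $0$ or $1$. A *walk* from $x$ to $y$ is a non-empty composable sequence $(f_n,\epsilon_n),\dots,(f_1,\epsilon_1)$ of non-zero morphisms $f_i$ with signs $\epsilon_i=\pm1$, where $(f,-1)$ goes from the target of $f$ to the source of $f$. Assume that $\mathcal C$ is *connected*: any two objects are joined by a walk. A *grading* $X$ of $\mathcal C$ by a group $\Gamma_X$ is a decomposition ${}_y\mathcal C_x=\bigoplus_{s\in\Gamma_X}X^s{}_y\mathcal C_x$ for all objects $x,y$, with $X^t{}_z\mathcal C_y\cdot X^s{}_y\mathcal C_x\subset X^{ts}{}_z\mathcal C_x$. A walk of homogeneous morphisms has degree $\deg_X w=(\deg_X f_n)^{\epsilon_n}\cdots(\deg_X f_1)^{\epsilon_1}$. The grading is *connected* if for all objects $x,y$ and all $s\in\Gamma_X$ there is a homogeneous walk from $x$ to $y$ of degree $s$. Choose a non-zero morphism ${}_ye_x$ in each non-zero space ${}_y\mathcal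 C_x$, with ${}_xe_x={}_x1_x$. The CW-complex $CW(\mathcal C)$ has the objects of $\mathcal C$ as $0$-cells, a $1$-cell from $x$ to $y$ for each ${}_ye_x\neq0$ with $x\neq y$, and, for each triple of objects $x,y,z$ with $x\ne y$, $y\neq z$ and ${}_ze_y\,{}_ye_x\neq0$, a triangular $2$-cell attached along the $1$-cells ${}_ye_x$, ${}_ze_y$ and ${}_ze_x$ (the side ${}_ze_x$ being the constant path at $x$ if $z=x$). A walk describes a path in $CW(\mathcal C)$: a non-zero morphism from $x$ to $y$ describes the $1$-cell ${}_ye_x$ if $x\ne y$ and the constant path if $x=y$, and the sign $-1$ reverses the path. For a closed walk $w$ at $c_0$ let $[w]\in\pi_1(CW(\mathcal C),c_0)$ be the homotopy class of its loop; products in $\pi_1$ are read from right to left, as for composition. Let $X$ be a connected grading of $\mathcal C$, let $c_0$ be an object, and let $u=({}_xu_{c_0})_x$ be a set of *connector walks*: homogeneous walks from $c_0$ to $x$ with $\deg_X{}_xu_{c_0}=1$ and ${}_{c_0}u_{c_0}={}_{c_0}1_{c_0}$. Let $Z_{X,u}$ be defined by giving ${}_ye_x\neq0$ the degree $[\,{}_yu_{c_0}^{-1}\;{}_ye_x\;{}_xu_{c_0}]\in\pi_1(CW(\mathcal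 C),c_0)$. **Theorem.** $Z_{X,u}$ is a connected grading of $\mathcal C$ by $\pi_1(CW(\mathcal C),c_0)$, and $X$ is a quotient of $Z_{X,u}$ through a unique group morphism. That is, there is exactly one surjective group morphism $\varphi:\pi_1(CW(\mathcal C),c_0)\to\Gamma_X$ such that $$X^s{}_y\mathcal C_x=\bigoplus_{\varphi(r)=s}Z_{X,u}^r\,{}_y\mathcal C_x\qquad\text{for all objects }x,y\text{ and all }s\in\Gamma_X .$$ Moreover, every closed walk $w$ at $c_0$ is $X$-homogeneous, and $\varphi([w])=\deg_X w$. -/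

import Mathlib

open CategoryTheory

universe w u v t

namespace SchurianCW

/-! ### Linear categories, walks, gradings -/

section Walks

variable {C : Type u} [Category.{v} C] [Preadditive C]

/-- A virtual morphism from `x` to `y`: either `(f, 1)` with `f : x ⟶ y` non-zero,
or `(f, -1)` with `f : y ⟶ x` non-zero. -/
inductive VirtualHom : C → C → Type (max u v)
  | fwd {x y : C} (f : x ⟶ y) (hf : f ≠ 0) : VirtualHom x y
  | bwd {x y : C} (f : y ⟶ x) (hf : f ≠ 0) : VirtualHom x y

/-- The same morphism with the opposite sign. -/
def VirtualHom.inv {x y : C} : VirtualHom x y → VirtualHom y x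
  | .fwd f hf => .bwd f hf
  | .bwd f hf => .fwd f hf

/-- A walk from `x` to `y`: a non-empty sequence of composable virtual morphisms, the first one
starting at `x` and the last one ending at `y`. -/
inductive Walk : C → C → Type (max u v)
  | single {x y : C} (a : VirtualHom x y) : Walk x y
  | snoc {x y z : C} (p : Walk x y) (a : VirtualHom y z) : Walk x z

/-- First the walk `p`, then the walk `q`. -/
def Walk.append {x y : C} (p : Walk x y) : {z : C} → Walk y z → Walk x z
  | _, .single a => .snoc p a
  | _, .snoc q a => .snoc (p.append q) a

/-- The inverse walk. -/
def Walk.inv {x y : C} : Walk x y → Walk y x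
  | .single a => .single a.inv
  | .snoc p a => (Walk.single a.inv).append p.inv

variable (C) in
/-- A linear category is connected if any two objects are joined by a walk. -/
def IsWalkConnected : Prop := ∀ x y : C, Nonempty (Walk x y)

end Walks

section Gradings

variable (k : Type w) [Field k] (C : Type u) [Category.{v} C] [Preadditive C] [Linear k C]

/-- A linear category is Schurian if each space of morphisms has dimension zero or one. -/
def IsSchurian : Prop :=
  ∀ x y : C, Module.rank k (x ⟶ y) = 0 ∨ Module.rank k (x ⟶ y) = 1

/-- A family of subspaces of the spaces of morphisms, indexed by a group: `X s x y` is the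
prospective space of homogeneous morphisms of degree `s` from `x` to `y`. -/
abbrev HomFamily (Γ : Type t) : Type _ := Γ → ∀ x y : C, Submodule k (x ⟶ y)

variable {k C} {Γ : Type t} [Group Γ]

open Classical in
/-- The family `X` is a grading of the linear category `C` by the group `Γ`. -/
structure IsGrading (X : HomFamily k C Γ) : Prop where
  /-- Each space of morphisms is the direct sum of its homogeneous components. -/
  isInternal : ∀ x y : C, DirectSum.IsInternal fun s : Γ => X s x y
  /-- `f ≫ g` is "`g` after `f`", so its degree is `(deg g) * (deg f)`. -/
  comp_mem : ∀ {x y z : C} {s r : Γ} {f : x ⟶ y} {g : y ⟶ z},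
    f ∈ X s x y → g ∈ X r y z → f ≫ g ∈ X (r * s) x z

/-- The virtual morphism is homogeneous of degree `s`; here `deg (f, -1) = (deg f)⁻¹`. -/
def VirtualHom.HasDegree (X : HomFamily k C Γ) :
    {x y : C} → VirtualHom x y → Γ → Prop
  | x, y, .fwd f _, s => f ∈ X s x y
  | x, y, .bwd f _, s => f ∈ X s⁻¹ y x

/-- The walk is homogeneous of degree `s`; the degree of the walk `aₙ, …, a₁` is the ordered
product `deg aₙ * ⋯ * deg a₁`. -/
def Walk.HasDegree (X : HomFamily k C Γ) :
    {x y : C} → Walk x y → Γ → Prop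
  | _, _, .single a, s => a.HasDegree X s
  | _, _, .snoc p a, s => ∃ r₁ r₂ : Γ, p.HasDegree X r₁ ∧ a.HasDegree X r₂ ∧ s = r₂ * r₁

/-- A grading is connected if any two objects are joined by homogeneous walks of every degree. -/
def IsConnectedGrading (X : HomFamily k C Γ) : Prop :=
  ∀ (x y : C) (s : Γ), ∃ p : Walk x y, p.HasDegree X s

/-- A set of connector walks for `X` at `c₀`: walks of degree `1` from `c₀` to each object, the
one to `c₀` itself being the identity of `c₀`. -/
structure ConnectorWalks (X : HomFamily k C Γ) (c₀ : C) where
  walk : ∀ x : C, Walk c₀ x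
  hasDegree_one : ∀ x : C, (walk x).HasDegree X 1
  walk_base : ∃ h : 𝟙 c₀ ≠ 0, walk c₀ = .single (.fwd (𝟙 c₀) h)

/-- The grading `X` is a quotient of the grading `Z` through the group morphism `φ`: `φ` is
surjective and `X s x y` is the direct sum of the `Z r x y` with `φ r = s`. -/
structure IsQuotientVia {Δ : Type*} [Group Δ] (X : HomFamily k C Γ) (Z : HomFamily k C Δ)
    (φ : Δ →* Γ) : Prop where
  surjective : Function.Surjective φ
  indep : ∀ (s : Γ) (x y : C), iSupIndep fun r : {r : Δ // φ r = s} => Z r x y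
  eq_iSup : ∀ (s : Γ) (x y : C), X s x y = ⨆ r : {r : Δ // φ r = s}, Z r x y

end Gradings

/-! ### The CW-complex of a Schurian category -/

section Complex

variable {C : Type u} [Category.{v} C] [Preadditive C]

variable (C) in
/-- A choice of a morphism in each space of morphisms, non-zero whenever the space is non-zero,
and equal to the identity on the diagonal. -/
structure MorphismChoice where
  mor : ∀ x y : C, x ⟶ y
  mor_ne_zero : ∀ {x y : C} (f : x ⟶ y), f ≠ 0 → mor x y ≠ 0
  mor_self : ∀ x : C, mor x x = 𝟙 x

variable (e : MorphismChoice C)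

/-- The `1`-cells: one for each non-zero chosen morphism between two distinct objects. -/
structure OneCell where
  src : C
  tgt : C
  ne : src ≠ tgt
  mor_ne_zero : e.mor src tgt ≠ 0

/-- The `2`-cells: one for each pair of consecutive `1`-cells `x → y → z` such that the
composite of the chosen morphisms is non-zero. The case `z = x` is allowed. -/
structure TwoCell where
  x : C
  y : C
  z : C
  ne_xy : x ≠ y
  ne_yz : y ≠ z
  mor_xy : e.mor x y ≠ 0
  mor_yz : e.mor y z ≠ 0
  mor_xz : e.mor x z ≠ 0
  comp_ne_zero : e.mor x y ≫ e.mor y z ≠ 0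

/-- The `1`-cell `x → y` of a `2`-cell `x → y → z`. -/
def TwoCell.edgeXY {e : MorphismChoice C} (c : TwoCell e) : OneCell e :=
  ⟨c.x, c.y, c.ne_xy, c.mor_xy⟩

/-- The `1`-cell `y → z` of a `2`-cell `x → y → z`. -/
def TwoCell.edgeYZ {e : MorphismChoice C} (c : TwoCell e) : OneCell e :=
  ⟨c.y, c.z, c.ne_yz, c.mor_yz⟩

/-- The `1`-cell `x → z` of a `2`-cell `x → y → z` with `x ≠ z`. -/
def TwoCell.edgeXZ {e : MorphismChoice C} (c : TwoCell e) (h : c.x ≠ c.z) : OneCell e :=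
  ⟨c.x, c.z, h, c.mor_xz⟩

/-- The model of a closed `2`-cell: the triangle `{(a, b) : 0 ≤ b ≤ a ≤ 1}`, with corners
`(0, 0)`, `(1, 0)`, `(1, 1)`. -/
abbrev Triangle : Type := {p : unitInterval × unitInterval // p.2 ≤ p.1}

/-- The side of the triangle from `(0, 0)` to `(1, 0)`. -/
def Triangle.side₀₁ (s : unitInterval) : Triangle := ⟨(s, 0), s.2.1⟩

/-- The side of the triangle from `(1, 0)` to `(1, 1)`. -/
def Triangle.side₁₂ (s : unitInterval) : Triangle := ⟨(1, s), s.2.2⟩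

/-- The side of the triangle from `(0, 0)` to `(1, 1)`. -/
def Triangle.side₀₂ (s : unitInterval) : Triangle := ⟨(s, s), le_refl s⟩

/-- The topological disjoint union of all closed cells. -/
abbrev Cells : Type u :=
  (Σ _ : C, PUnit.{1}) ⊕ (Σ _ : OneCell e, unitInterval) ⊕ (Σ _ : TwoCell e, Triangle)

/-- The point of the disjoint union given by a `0`-cell. -/
def pt₀ (x : C) : Cells e := .inl ⟨x, PUnit.unit⟩

/-- The points of a closed `1`-cell. -/
def pt₁ (a : OneCell e) (s : unitInterval) : Cells e := .inr (.inl ⟨a, s⟩)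

/-- The points of a closed `2`-cell. -/
def pt₂ (c : TwoCell e) (p : Triangle) : Cells e := .inr (.inr ⟨c, p⟩)

/-- The attaching relation. The endpoints of a `1`-cell are glued to its source and target; the
sides of the triangle of a `2`-cell `x → y → z` are glued to the `1`-cells `x → y`, `y → z` and
`x → z`, the last one being replaced by the `0`-cell `x` if `x = z`. -/
inductive Attach : Cells e → Cells e → Prop
  | src (a : OneCell e) : Attach (pt₁ e a 0) (pt₀ e a.src)
  | tgt (a : OneCell e) : Attach (pt₁ e a 1) (pt₀ e a.tgt)
  | sideXY (c : TwoCell e) (s : unitInterval) :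
      Attach (pt₂ e c (Triangle.side₀₁ s)) (pt₁ e c.edgeXY s)
  | sideYZ (c : TwoCell e) (s : unitInterval) :
      Attach (pt₂ e c (Triangle.side₁₂ s)) (pt₁ e c.edgeYZ s)
  | sideXZ (c : TwoCell e) (h : c.x ≠ c.z) (s : unitInterval) :
      Attach (pt₂ e c (Triangle.side₀₂ s)) (pt₁ e (c.edgeXZ h) s)
  | sideXX (c : TwoCell e) (h : c.x = c.z) (s : unitInterval) :
      Attach (pt₂ e c (Triangle.side₀₂ s)) (pt₀ e c.x)

/-- The CW-complex: the disjoint union of the closed cells modulo the equivalence relation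
generated by the attaching relation. -/
def CW : Type u := Quot (Attach e)

/-- The quotient topology. -/
instance : TopologicalSpace (CW e) := inferInstanceAs (TopologicalSpace (Quot (Attach e)))

/-- The `0`-cell of the complex given by an object. -/
def CW.vertex (x : C) : CW e := Quot.mk _ (pt₀ e x)

/-- The path that runs through a `1`-cell, from its source to its target. -/
def OneCell.path {e : MorphismChoice C} (a : OneCell e) :
    Path (CW.vertex e a.src) (CW.vertex e a.tgt) where
  toFun s := Quot.mk _ (pt₁ e a s)
  continuous_toFun :=
    continuous_quot_mk.comp (continuous_inr.comp (continuous_inl.comp continuous_sigmaMk))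
  source' := Quot.sound (Attach.src a)
  target' := Quot.sound (Attach.tgt a)

open Classical in
/-- The path from `x` to `y` described by the non-zero chosen morphism from `x` to `y`: it runs
through the corresponding `1`-cell if `x ≠ y`, and is constant if `x = y`. -/
noncomputable def edgePath {x y : C} (h : e.mor x y ≠ 0) :
    Path (CW.vertex e x) (CW.vertex e y) :=
  if hxy : x = y then (Path.refl (CW.vertex e x)).cast rfl (congrArg (CW.vertex e) hxy.symm)
  else OneCell.path (e := e) ⟨x, y, hxy, h⟩

/-- The path described by a virtual morphism. -/
noncomputable def VirtualHom.path :
    {x y : C} → VirtualHom x y → Path (CW.vertex e x) (CW.vertex e y)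
  | _, _, .fwd f hf => edgePath e (e.mor_ne_zero f hf)
  | _, _, .bwd f hf => (edgePath e (e.mor_ne_zero f hf)).symm

/-- The path described by a walk. -/
noncomputable def Walk.path :
    {x y : C} → Walk x y → Path (CW.vertex e x) (CW.vertex e y)
  | _, _, .single a => a.path e
  | _, _, .snoc p a => (p.path).trans (a.path e)

/-- The homotopy class of the loop described by a closed walk. In Mathlib's fundamental group the
product `p * q` is the class of `q` followed by `p`, in agreement with the order of composition
of morphisms and with the order of the factors in the degree of a walk. -/
noncomputable def Walk.loopClass {c : C} (p : Walk c c) :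
    FundamentalGroup (CW e) (CW.vertex e c) :=
  FundamentalGroup.fromPath (Path.Homotopic.Quotient.mk (p.path e))

end Complex

section ZGrading

variable {k : Type w} [Field k] {C : Type u} [Category.{v} C] [Preadditive C] [Linear k C]
  {Γ : Type t} [Group Γ] {X : HomFamily k C Γ} {c₀ : C}

/-- The degree of the non-zero chosen morphism `e` from `x` to `y`: the homotopy class of the loop
that runs first through the connector walk of `x`, then through `e`, and then backwards through
the connector walk of `y`. -/
noncomputable def zDegree (e : MorphismChoice C) (W : ConnectorWalks X c₀) {x y : C}
    (h : e.mor x y ≠ 0) : FundamentalGroup (CW e) (CW.vertex e c₀) :=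
  Walk.loopClass e
    (((W.walk x).append (.single (.fwd (e.mor x y) h))).append (W.walk y).inv)

/-- The grading by the fundamental group of the complex: the component of degree `r` from `x` to
`y` is spanned by the chosen morphism if that morphism is non-zero of degree `r`, and is zero
otherwise. -/
noncomputable def zGrading (e : MorphismChoice C) (W : ConnectorWalks X c₀) :
    HomFamily k C (FundamentalGroup (CW e) (CW.vertex e c₀)) :=
  fun r x y => Submodule.span k {f | f = e.mor x y ∧ ∃ h : e.mor x y ≠ 0, zDegree e W h = r}

end ZGrading

end SchurianCW

/-!
The proof compares walks in the category with paths in the complex, in both directions.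

*Every path between vertices is homotopic to the path of a walk* (`CW.isWalkClass`). The barycentric
coordinate at the vertex `x` is a continuous function `CW.weight e x` on the complex, and the open
stars `CW.star e x` where these functions are positive form an open cover. The star of `x` contracts
to `x` by scaling barycentric coordinates (`CW.flow`), so each point `q` of the star has a
distinguished class `CW.radial` of paths from `x` to `q`, and a path inside the star is homotopic to
a difference of radial paths (`CW.radial_comp_transport`). For a point in two stars the two radial
paths differ by an edge of the cell that contains the point, hence by a walk
(`CW.isWalkClass_radial_comp_inv_radial`). Subdividing a path into pieces inside stars gives the
claim.

*Walks with homotopic paths have the same degree* (`IsCocycle.degree_eq_of_pathClass_eq`). In a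
Schurian category a non-zero morphism is homogeneous for every grading, and its degree depends only
on its source and target. This degree is a cocycle: it is multiplicative along the boundary of each
`2`-cell. A cocycle glues copies of the discrete group over the open stars to a covering space
(`IsCocycle.bundle`), and the monodromy along the path of a walk is left translation by the degree
of the walk (`IsCocycle.monodromy_walk`).

Together these two facts give the morphism `φ`, which maps the class of a closed walk to the degree
of the walk (`IsCocycle.exists_monoidHom`). The family `zGrading` is a grading because consecutive
edges whose composite is non-zero bound a `2`-cell (`pathClass_fwd_comp`). It is connected because
every element of the fundamental group is the class of a closed walk. The morphism `φ` carries it to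
`X` because connector walks have degree `1`. Finally, a morphism through which `X` is a quotient is
prescribed on the degrees of the chosen morphisms, and these generate the fundamental group
(`map_close_pathClass`), which gives uniqueness.
-/

namespace SchurianCW

/-! ### Path classes carried by contractible spaces -/

section Transport

variable {T S B : Type*} [TopologicalSpace T] [TopologicalSpace S] [TopologicalSpace B]
  [ContractibleSpace T] [ContractibleSpace S]

/-- The class of the image under `f` of any path from `a` to `b`. Since `T` is contractible, the
choice of the path does not matter. The end points `x` and `y` are only required to be equal to
`f a` and `f b`, which spares casts where they are vertices of a cell complex. -/
noncomputable def transport (f : C(T, B)) {x y : B} (a b : T) (ha : f a = x) (hb : f b = y) :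
    FundamentalGroupoid.mk x ⟶ FundamentalGroupoid.mk y :=
  Path.Homotopic.Quotient.mk
    (((PathConnectedSpace.somePath a b).map f.continuous).cast ha.symm hb.symm)

theorem transport_eq_mk (f : C(T, B)) {x y : B} {a b : T} (ha : f a = x) (hb : f b = y)
    (δ : Path a b) (γ : Path x y) (h : ∀ s, γ s = f (δ s)) :
    transport f a b ha hb = Path.Homotopic.Quotient.mk γ := by
  subst ha hb
  obtain rfl : γ = δ.map f.continuous := by ext s; exact h s
  exact Path.Homotopic.Quotient.eq.mpr
    ((SimplyConnectedSpace.paths_homotopic (PathConnectedSpace.somePath a b) δ).map f)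

theorem transport_refl (f : C(T, B)) {x : B} (a : T) (ha : f a = x) :
    transport f a a ha ha = 𝟙 _ :=
  transport_eq_mk f ha ha (Path.refl a) (Path.refl x) fun _ => ha.symm

theorem transport_comp (f : C(T, B)) {x y z : B} (a b c : T) (ha : f a = x) (hb : f b = y)
    (hc : f c = z) : transport f a b ha hb ≫ transport f b c hb hc = transport f a c ha hc := by
  subst ha hb hc
  symm
  refine transport_eq_mk f rfl rfl
    ((PathConnectedSpace.somePath a b).trans (PathConnectedSpace.somePath b c)) _ fun s => ?_
  exact congrFun (congrArg DFunLike.coe (Path.map_trans _ _ f.continuous).symm) s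

theorem transport_inv (f : C(T, B)) {x y : B} (a b : T) (ha : f a = x) (hb : f b = y) :
    inv (transport f a b ha hb) = transport f b a hb ha := by
  rw [IsIso.inv_eq_of_hom_inv_id]
  rw [transport_comp, transport_refl]

theorem transport_precomp (f : C(T, B)) (g : C(S, T)) (h : C(S, B)) (hfg : ∀ s, h s = f (g s))
    {x y : B} (a b : S) (ha : h a = x) (hb : h b = y) :
    transport h a b ha hb
      = transport f (g a) (g b) ((hfg a).symm.trans ha) ((hfg b).symm.trans hb) := by
  obtain rfl : h = f.comp g := by ext s; exact hfg s
  subst ha hb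
  symm
  exact transport_eq_mk f rfl rfl ((PathConnectedSpace.somePath a b).map g.continuous) _
    fun s => rfl

theorem transport_const (f : C(T, B)) {x : B} (hf : ∀ s, f s = x) (a b : T) :
    transport f a b (hf a) (hf b) = 𝟙 _ :=
  transport_eq_mk f (hf a) (hf b) (PathConnectedSpace.somePath a b) (Path.refl x)
    fun _ => (hf _).symm

end Transport

/-! ### Barycentric weights and open stars -/

section Coordinates

open unitInterval

/-- The point of the triangle with the given coordinates, which are first truncated so that
`0 ≤ v ≤ u ≤ 1`. -/
noncomputable def Triangle.mk (u v : ℝ) : Triangle :=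
  ⟨(Set.projIcc 0 1 zero_le_one u, Set.projIcc 0 1 zero_le_one u ⊓ Set.projIcc 0 1 zero_le_one v),
    inf_le_left⟩

theorem Triangle.continuous_mk : Continuous fun p : ℝ × ℝ => Triangle.mk p.1 p.2 := by
  unfold Triangle.mk
  have h : Continuous (Set.projIcc (0 : ℝ) 1 zero_le_one) := continuous_projIcc
  fun_prop

theorem Triangle.mk_eq {u v : ℝ} (hv : 0 ≤ v) (hvu : v ≤ u) (hu : u ≤ 1) :
    Triangle.mk u v = ⟨(⟨u, hv.trans hvu, hu⟩, ⟨v, hv, hvu.trans hu⟩), hvu⟩ := by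
  have h₁ := Set.projIcc_of_mem (zero_le_one' ℝ) (x := u) ⟨hv.trans hvu, hu⟩
  have h₂ := Set.projIcc_of_mem (zero_le_one' ℝ) (x := v) ⟨hv, hvu.trans hu⟩
  refine Subtype.ext (Prod.ext h₁ ?_)
  change Set.projIcc 0 1 zero_le_one u ⊓ Set.projIcc 0 1 zero_le_one v = _
  rw [h₁, h₂]
  exact inf_eq_right.mpr hvu

theorem Triangle.mk_coe (p : Triangle) : Triangle.mk p.1.1 p.1.2 = p :=
  Triangle.mk_eq p.1.2.2.1 p.2 p.1.1.2.2

theorem Triangle.mk_zero_right (u : ℝ) :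
    Triangle.mk u 0 = Triangle.side₀₁ (Set.projIcc 0 1 zero_le_one u) := by
  refine Subtype.ext (Prod.ext rfl ?_)
  change Set.projIcc 0 1 zero_le_one u ⊓ Set.projIcc 0 1 zero_le_one 0 = 0
  rw [Set.projIcc_left]
  exact inf_eq_right.mpr (Set.projIcc 0 1 zero_le_one u).2.1

theorem Triangle.mk_one_left (v : ℝ) :
    Triangle.mk 1 v = Triangle.side₁₂ (Set.projIcc 0 1 zero_le_one v) := by
  refine Subtype.ext (Prod.ext (Set.projIcc_right zero_le_one) ?_)
  change Set.projIcc 0 1 zero_le_one 1 ⊓ Set.projIcc 0 1 zero_le_one v =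
    Set.projIcc 0 1 zero_le_one v
  rw [Set.projIcc_right]
  exact inf_eq_right.mpr (Set.projIcc 0 1 zero_le_one v).2.2

theorem Triangle.mk_self (u : ℝ) :
    Triangle.mk u u = Triangle.side₀₂ (Set.projIcc 0 1 zero_le_one u) :=
  Subtype.ext (Prod.ext rfl (inf_idem _))

open Classical in
/-- The Kronecker symbol of two objects. -/
noncomputable def delta {C : Type*} (x y : C) : ℝ := if x = y then 1 else 0

theorem delta_self {C : Type*} (x : C) : delta x x = 1 := if_pos rfl

theorem delta_of_ne {C : Type*} {x y : C} (h : x ≠ y) : delta x y = 0 := if_neg h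

theorem delta_eq_or {C : Type*} (x y : C) : (x = y ∧ delta x y = 1) ∨ (x ≠ y ∧ delta x y = 0) := by
  by_cases h : x = y
  · exact .inl ⟨h, if_pos h⟩
  · exact .inr ⟨h, if_neg h⟩

end Coordinates

section Stars

variable {C : Type u} [Category.{v} C] [Preadditive C] (e : MorphismChoice C)

open unitInterval

/-- The sum of the barycentric coordinates of a point of a closed cell at the corners of the cell
that lie over the object `x`. A triangle has two such corners if it is the `2`-cell
`x → y → x`. -/
noncomputable def cellWeight (x : C) : Cells e → ℝ
  | .inl ⟨y, _⟩ => delta y x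
  | .inr (.inl ⟨a, s⟩) => (1 - (s : ℝ)) * delta a.src x + s * delta a.tgt x
  | .inr (.inr ⟨c, p⟩) => (1 - (p.1.1 : ℝ)) * delta c.x x + ((p.1.1 : ℝ) - p.1.2) * delta c.y x
      + p.1.2 * delta c.z x

theorem cellWeight_pt₀ (x y : C) : cellWeight e x (pt₀ e y) = delta y x := rfl

theorem cellWeight_pt₁ (x : C) (a : OneCell e) (s : I) :
    cellWeight e x (pt₁ e a s) = (1 - (s : ℝ)) * delta a.src x + s * delta a.tgt x := rfl

theorem cellWeight_pt₂ (x : C) (c : TwoCell e) (p : Triangle) :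
    cellWeight e x (pt₂ e c p) = (1 - (p.1.1 : ℝ)) * delta c.x x
      + ((p.1.1 : ℝ) - p.1.2) * delta c.y x + p.1.2 * delta c.z x := rfl

theorem continuous_cellWeight (x : C) : Continuous (cellWeight e x) := by
  refine continuous_sum_dom.2 ⟨?_, continuous_sum_dom.2 ⟨?_, ?_⟩⟩ <;>
    refine continuous_sigma fun a => ?_
  · exact continuous_const
  · change Continuous fun s : I => (1 - (s : ℝ)) * delta a.src x + s * delta a.tgt x
    fun_prop
  · change Continuous fun p : Triangle => (1 - (p.1.1 : ℝ)) * delta a.x x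
      + ((p.1.1 : ℝ) - p.1.2) * delta a.y x + p.1.2 * delta a.z x
    fun_prop

theorem cellWeight_eq_of_attach (x : C) {ξ η : Cells e} (h : Attach e ξ η) :
    cellWeight e x ξ = cellWeight e x η := by
  cases h with
  | src a => simp [cellWeight_pt₀, cellWeight_pt₁]
  | tgt a => simp [cellWeight_pt₀, cellWeight_pt₁]
  | sideXY c s =>
    simp [cellWeight_pt₁, cellWeight_pt₂, Triangle.side₀₁, TwoCell.edgeXY]
  | sideYZ c s =>
    simp [cellWeight_pt₁, cellWeight_pt₂, Triangle.side₁₂, TwoCell.edgeYZ]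
  | sideXZ c h s =>
    simp [cellWeight_pt₁, cellWeight_pt₂, Triangle.side₀₂, TwoCell.edgeXZ]
  | sideXX c h s =>
    simp only [cellWeight_pt₀, cellWeight_pt₂, Triangle.side₀₂, ← h]
    ring

/-- The quotient map from the disjoint union of the closed cells to the complex. -/
def CW.mk (ξ : Cells e) : CW e := Quot.mk _ ξ

variable {e} in
theorem CW.sound {ξ η : Cells e} (h : Attach e ξ η) : CW.mk e ξ = CW.mk e η := Quot.sound h

theorem CW.isQuotientMap_mk : Topology.IsQuotientMap (CW.mk e) := isQuotientMap_quot_mk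

theorem CW.isOpenEmbedding_pt₀ (x : C) :
    Topology.IsOpenEmbedding fun _ : PUnit.{1} => pt₀ e x :=
  Topology.IsOpenEmbedding.inl.comp
    (@Topology.IsOpenEmbedding.sigmaMk C (fun _ => PUnit.{1}) _ x)

theorem CW.isOpenEmbedding_pt₁ (a : OneCell e) : Topology.IsOpenEmbedding (pt₁ e a) :=
  Topology.IsOpenEmbedding.inr.comp
    (Topology.IsOpenEmbedding.inl.comp (Topology.IsOpenEmbedding.sigmaMk (i := a)))

theorem CW.isOpenEmbedding_pt₂ (c : TwoCell e) : Topology.IsOpenEmbedding (pt₂ e c) :=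
  Topology.IsOpenEmbedding.inr.comp
    (Topology.IsOpenEmbedding.inr.comp (Topology.IsOpenEmbedding.sigmaMk (i := c)))

/-- The barycentric coordinate at the vertex `x`, as a function on the complex. -/
noncomputable def CW.weight (x : C) : CW e → ℝ :=
  Quot.lift (cellWeight e x) fun _ _ h => cellWeight_eq_of_attach e x h

theorem CW.continuous_weight (x : C) : Continuous (CW.weight e x) :=
  (CW.isQuotientMap_mk e).continuous_iff.2 (continuous_cellWeight e x)

/-- The open star of the vertex `x`. -/
def CW.star (x : C) : Set (CW e) := {q | 0 < CW.weight e x q}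

theorem CW.isOpen_star (x : C) : IsOpen (CW.star e x) :=
  isOpen_lt continuous_const (CW.continuous_weight e x)

theorem CW.vertex_mem_star_iff {x y : C} : CW.vertex e y ∈ CW.star e x ↔ y = x := by
  change 0 < delta y x ↔ _
  rcases delta_eq_or y x with ⟨h, h'⟩ | ⟨h, h'⟩
  · rw [h']; exact iff_of_true one_pos h
  · rw [h']; exact iff_of_false (lt_irrefl 0) h

theorem CW.exists_mem_star (q : CW e) : ∃ x, q ∈ CW.star e x := by
  obtain ⟨ξ, rfl⟩ := (CW.isQuotientMap_mk e).surjective q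
  change ∃ x, 0 < cellWeight e x ξ
  rcases ξ with ⟨y, _⟩ | ⟨a, s⟩ | ⟨c, p⟩
  · exact ⟨y, by change 0 < delta y y; rw [delta_self]; exact one_pos⟩
  · by_cases hs : (s : ℝ) < 1
    · refine ⟨a.src, ?_⟩
      change 0 < (1 - (s : ℝ)) * delta a.src a.src + s * delta a.tgt a.src
      rw [delta_self, delta_of_ne a.ne.symm]
      linarith
    · refine ⟨a.tgt, ?_⟩
      change 0 < (1 - (s : ℝ)) * delta a.src a.tgt + s * delta a.tgt a.tgt
      rw [delta_self, delta_of_ne a.ne]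
      linarith
  · obtain ⟨⟨a, b⟩, hab⟩ := p
    have hab' : (b : ℝ) ≤ a := hab
    have ha := a.2.2
    have hb := b.2.1
    have hnn : ∀ x y : C, 0 ≤ delta x y := fun x y => by
      rcases delta_eq_or x y with ⟨_, h⟩ | ⟨_, h⟩ <;> norm_num [h]
    by_contra! H
    have key : ∀ x, (1 - (a : ℝ)) * delta c.x x + ((a : ℝ) - b) * delta c.y x + b * delta c.z x
      ≤ 0 := H
    have h₁ := key c.x
    have h₂ := key c.y
    have h₃ := key c.z
    rw [delta_self] at h₁ h₂ h₃
    have := mul_nonneg (sub_nonneg.2 ha) (hnn c.x c.y)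
    have := mul_nonneg (sub_nonneg.2 ha) (hnn c.x c.z)
    have := mul_nonneg (sub_nonneg.2 hab') (hnn c.y c.x)
    have := mul_nonneg (sub_nonneg.2 hab') (hnn c.y c.z)
    have := mul_nonneg hb (hnn c.z c.x)
    have := mul_nonneg hb (hnn c.z c.y)
    linarith

/-! ### The contraction of an open star -/

/-- The contraction of the open star of `x` inside a closed cell: at time `t` the barycentric
coordinate `β` at a corner over the object `y` becomes `t * β + (1 - t) * (δ * β / W)`, where `δ`
is `1` if `y = x` and `0` otherwise, and `W` is the weight at `x`. At time `1` this is the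
identity, and at time `0` it is the central projection to the face spanned by the corners over
`x`. It is only meaningful where the weight is positive. -/
noncomputable def cellFlow (x : C) (t : I) : Cells e → Cells e
  | .inl a => .inl a
  | .inr (.inl ⟨a, s⟩) => pt₁ e a (Set.projIcc 0 1 zero_le_one
      (t * s + (1 - t) * (s * delta a.tgt x / cellWeight e x (pt₁ e a s)) : ℝ))
  | .inr (.inr ⟨c, p⟩) => pt₂ e c (Triangle.mk
      (t * p.1.1 + (1 - t) * ((((p.1.1 : ℝ) - p.1.2) * delta c.y x + p.1.2 * delta c.z x)
        / cellWeight e x (pt₂ e c p)))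
      (t * p.1.2 + (1 - t) * (p.1.2 * delta c.z x / cellWeight e x (pt₂ e c p))))

theorem cellFlow_pt₁ (x : C) (t : I) (a : OneCell e) (s : I) :
    cellFlow e x t (pt₁ e a s) = pt₁ e a (Set.projIcc 0 1 zero_le_one
      (t * s + (1 - t) * (s * delta a.tgt x / cellWeight e x (pt₁ e a s)) : ℝ)) := rfl

theorem cellFlow_pt₂ (x : C) (t : I) (c : TwoCell e) (p : Triangle) :
    cellFlow e x t (pt₂ e c p) = pt₂ e c (Triangle.mk
      (t * p.1.1 + (1 - t) * ((((p.1.1 : ℝ) - p.1.2) * delta c.y x + p.1.2 * delta c.z x)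
        / cellWeight e x (pt₂ e c p)))
      (t * p.1.2 + (1 - t) * (p.1.2 * delta c.z x / cellWeight e x (pt₂ e c p)))) := rfl

theorem mk_cellFlow_eq_of_attach (x : C) (t : I) {ξ η : Cells e} (h : Attach e ξ η)
    (hw : 0 < cellWeight e x η) :
    CW.mk e (cellFlow e x t ξ) = CW.mk e (cellFlow e x t η) := by
  have hwe := cellWeight_eq_of_attach e x h
  cases h with
  | src a =>
    have : cellFlow e x t (pt₁ e a 0) = pt₁ e a 0 := by
      rw [cellFlow_pt₁]; simp
    rw [this]
    exact CW.sound (Attach.src a)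
  | tgt a =>
    have : cellFlow e x t (pt₁ e a 1) = pt₁ e a 1 := by
      obtain rfl : a.tgt = x := (CW.vertex_mem_star_iff e).1 hw
      rw [cellFlow_pt₁, hwe, cellWeight_pt₀]
      simp [delta_self]
    rw [this]
    exact CW.sound (Attach.tgt a)
  | sideXY c s =>
    rw [cellFlow_pt₁, cellFlow_pt₂, hwe]
    have := CW.sound (Attach.sideXY c (Set.projIcc 0 1 zero_le_one
      (t * s + (1 - t) * (s * delta c.y x / cellWeight e x (pt₁ e c.edgeXY s)) : ℝ)))
    rw [← Triangle.mk_zero_right] at this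
    convert! this using 3
    simp [Triangle.side₀₁]
  | sideYZ c s =>
    rw [cellFlow_pt₁, cellFlow_pt₂, hwe]
    have := CW.sound (Attach.sideYZ c (Set.projIcc 0 1 zero_le_one
      (t * s + (1 - t) * (s * delta c.z x / cellWeight e x (pt₁ e c.edgeYZ s)) : ℝ)))
    rw [← Triangle.mk_one_left] at this
    convert! this using 4
    -- The coordinate at `c.x` vanishes on this side, so the other two sum to the weight.
    have hd : ((1 - (s : ℝ)) * delta c.y x + s * delta c.z x)
        / cellWeight e x (pt₁ e c.edgeYZ s) = 1 := div_self hw.ne'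
    simp [Triangle.side₁₂, hd]
  | sideXZ c h s =>
    rw [cellFlow_pt₁, cellFlow_pt₂, hwe]
    have := CW.sound (Attach.sideXZ c h (Set.projIcc 0 1 zero_le_one
      (t * s + (1 - t) * (s * delta c.z x / cellWeight e x (pt₁ e (c.edgeXZ h) s)) : ℝ)))
    rw [← Triangle.mk_self] at this
    convert! this using 4
    simp [Triangle.side₀₂]
  | sideXX c h s =>
    rw [cellFlow_pt₂]
    simp only [Triangle.side₀₂, sub_self, zero_mul, zero_add]
    rw [Triangle.mk_self]
    exact CW.sound (Attach.sideXX c h _)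

open Classical in
/-- The contraction of the open star of `x`, extended by the identity outside of the star. -/
noncomputable def CW.flow (x : C) (t : I) : CW e → CW e :=
  Quot.lift (fun ξ => if 0 < cellWeight e x ξ then CW.mk e (cellFlow e x t ξ) else CW.mk e ξ)
    fun ξ η h => by
      change (if _ then _ else _ : CW e) = (if _ then _ else _ : CW e)
      by_cases hw : 0 < cellWeight e x η
      · rw [if_pos hw, if_pos ((cellWeight_eq_of_attach e x h).symm ▸ hw)]
        exact mk_cellFlow_eq_of_attach e x t h hw
      · rw [if_neg hw, if_neg ((cellWeight_eq_of_attach e x h).symm ▸ hw)]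
        exact CW.sound h

theorem CW.flow_mk {x : C} (t : I) {ξ : Cells e} (h : 0 < cellWeight e x ξ) :
    CW.flow e x t (CW.mk e ξ) = CW.mk e (cellFlow e x t ξ) := if_pos h

theorem CW.flow_one {x : C} {q : CW e} (hq : q ∈ CW.star e x) : CW.flow e x 1 q = q := by
  obtain ⟨ξ, rfl⟩ := (CW.isQuotientMap_mk e).surjective q
  rw [CW.flow_mk e 1 hq]
  rcases ξ with ⟨y, _⟩ | ⟨a, s⟩ | ⟨c, p⟩
  · rfl
  · change CW.mk e (cellFlow e x 1 (pt₁ e a s)) = CW.mk e (pt₁ e a s)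
    rw [cellFlow_pt₁]
    simp
  · change CW.mk e (cellFlow e x 1 (pt₂ e c p)) = CW.mk e (pt₂ e c p)
    rw [cellFlow_pt₂]
    simp [Triangle.mk_coe]

theorem CW.mk_corner₀ (c : TwoCell e) :
    CW.mk e (pt₂ e c (Triangle.side₀₁ 0)) = CW.vertex e c.x :=
  (CW.sound (Attach.sideXY c 0)).trans (CW.sound (Attach.src c.edgeXY))

theorem CW.mk_corner₁ (c : TwoCell e) :
    CW.mk e (pt₂ e c (Triangle.side₀₁ 1)) = CW.vertex e c.y :=
  (CW.sound (Attach.sideXY c 1)).trans (CW.sound (Attach.tgt c.edgeXY))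

theorem CW.mk_corner₂ (c : TwoCell e) :
    CW.mk e (pt₂ e c (Triangle.side₁₂ 1)) = CW.vertex e c.z :=
  (CW.sound (Attach.sideYZ c 1)).trans (CW.sound (Attach.tgt c.edgeYZ))

theorem CW.flow_zero {x : C} {q : CW e} (hq : q ∈ CW.star e x) :
    CW.flow e x 0 q = CW.vertex e x := by
  obtain ⟨ξ, rfl⟩ := (CW.isQuotientMap_mk e).surjective q
  rw [CW.flow_mk e 0 hq]
  rcases ξ with ⟨y, _⟩ | ⟨a, s⟩ | ⟨c, p⟩
  · obtain rfl : y = x := (CW.vertex_mem_star_iff e).1 hq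
    rfl
  · have hw : 0 < cellWeight e x (pt₁ e a s) := hq
    change CW.mk e (cellFlow e x 0 (pt₁ e a s)) = _
    rw [cellFlow_pt₁]
    rcases delta_eq_or a.tgt x with ⟨rfl, h'⟩ | ⟨h, h'⟩
    · rw [cellWeight_pt₁, delta_self, delta_of_ne a.ne] at hw ⊢
      simp only [mul_zero, zero_add, mul_one] at hw ⊢
      rw [div_self hw.ne']
      simp only [Set.Icc.coe_zero, zero_mul, zero_add, sub_zero, mul_one, Set.projIcc_right]
      exact CW.sound (Attach.tgt a)
    · rw [cellWeight_pt₁, h'] at hw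
      rcases delta_eq_or a.src x with ⟨rfl, h''⟩ | ⟨_, h''⟩
      · rw [h']
        simp only [Set.Icc.coe_zero, zero_mul, zero_add, mul_zero, zero_div, Set.projIcc_left]
        exact CW.sound (Attach.src a)
      · rw [h''] at hw; simp at hw
  · have hw : 0 < cellWeight e x (pt₂ e c p) := hq
    change CW.mk e (cellFlow e x 0 (pt₂ e c p)) = _
    rw [cellFlow_pt₂]
    simp only [Set.Icc.coe_zero, zero_mul, zero_add, sub_zero, one_mul]
    rcases delta_eq_or c.y x with ⟨hy, hy'⟩ | ⟨hy, hy'⟩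
    · have hx' : delta c.x x = 0 := delta_of_ne fun h => c.ne_xy (h.trans hy.symm)
      have hz' : delta c.z x = 0 := delta_of_ne fun h => c.ne_yz (hy.trans h.symm)
      rw [cellWeight_pt₂, hx', hy', hz'] at hw ⊢
      simp only [mul_zero, zero_add, add_zero, mul_one, zero_div] at hw ⊢
      rw [div_self hw.ne', Triangle.mk_zero_right, Set.projIcc_right, ← hy]
      exact CW.mk_corner₁ e c
    · rw [hy']
      simp only [mul_zero, zero_add]
      rcases delta_eq_or c.x x with ⟨hx, hx'⟩ | ⟨hx, hx'⟩
      · rcases delta_eq_or c.z x with ⟨hz, hz'⟩ | ⟨hz, hz'⟩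
        · rw [Triangle.mk_self, ← hx]
          exact CW.sound (Attach.sideXX c (hx.trans hz.symm) _)
        · rw [hz']
          simp only [mul_zero, zero_div, Triangle.mk_zero_right, Set.projIcc_left, ← hx]
          exact CW.mk_corner₀ e c
      · rcases delta_eq_or c.z x with ⟨hz, hz'⟩ | ⟨hz, hz'⟩
        · rw [cellWeight_pt₂, hx', hy', hz'] at hw ⊢
          simp only [mul_zero, zero_add, mul_one] at hw ⊢
          rw [div_self hw.ne', Triangle.mk_one_left, Set.projIcc_right, ← hz]
          exact CW.mk_corner₂ e c
        · rw [cellWeight_pt₂, hx', hy', hz'] at hw; simp at hw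

theorem CW.flow_vertex (x : C) (t : I) : CW.flow e x t (CW.vertex e x) = CW.vertex e x :=
  CW.flow_mk e t ((CW.vertex_mem_star_iff e).2 rfl)

theorem continuousAt_mk_cellFlow {x : C} {ξ : Cells e} (hξ : 0 < cellWeight e x ξ) (t : I) :
    ContinuousAt (fun p : Cells e × I => CW.mk e (cellFlow e x p.2 p.1))
      (ξ, t) := by
  rcases ξ with ⟨y, _⟩ | ⟨a, s⟩ | ⟨c, p⟩
  · have ho := (CW.isOpenEmbedding_pt₀ e y).prodMap (.id (X := I))
    exact (ho.continuousAt_iff (x := (PUnit.unit, t))).1 continuousAt_const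
  · have ho := (CW.isOpenEmbedding_pt₁ e a).prodMap (.id (X := I))
    refine (ho.continuousAt_iff (x := (s, t))).1 ?_
    refine ((OneCell.path a).continuous.comp continuous_projIcc).continuousAt.comp
      (f := fun p : I × I =>
        (p.2 * p.1 + (1 - p.2) * (p.1 * delta a.tgt x / cellWeight e x (pt₁ e a p.1)) : ℝ)) ?_
    have hw : (1 - (s : ℝ)) * delta a.src x + s * delta a.tgt x ≠ 0 := hξ.ne'
    simp only [cellWeight_pt₁]
    fun_prop (disch := exact hw)
  · have ho := (CW.isOpenEmbedding_pt₂ e c).prodMap (.id (X := I))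
    refine (ho.continuousAt_iff (x := (p, t))).1 ?_
    have hc : Continuous fun p : Triangle => CW.mk e (pt₂ e c p) :=
      continuous_quot_mk.comp (continuous_inr.comp (continuous_inr.comp continuous_sigmaMk))
    refine (hc.comp Triangle.continuous_mk).continuousAt.comp
      (f := fun p : Triangle × I =>
        ((p.2 * p.1.1.1 + (1 - p.2) * ((((p.1.1.1 : ℝ) - p.1.1.2) * delta c.y x
          + p.1.1.2 * delta c.z x) / cellWeight e x (pt₂ e c p.1)) : ℝ),
        (p.2 * p.1.1.2 + (1 - p.2) * (p.1.1.2 * delta c.z x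
          / cellWeight e x (pt₂ e c p.1)) : ℝ))) ?_
    have hw : (1 - (p.1.1 : ℝ)) * delta c.x x + ((p.1.1 : ℝ) - p.1.2) * delta c.y x
      + p.1.2 * delta c.z x ≠ 0 := hξ.ne'
    simp only [cellWeight_pt₂]
    fun_prop (disch := exact hw)

/-- Joint continuity of the contraction. The restriction of the quotient map to the open star is a
quotient map, and so is its product with the locally compact unit interval. -/
theorem CW.continuous_flow (x : C) :
    Continuous fun p : CW.star e x × I => CW.flow e x p.2 p.1 := by
  refine ((CW.isQuotientMap_mk e).restrictPreimage_isOpen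
    (CW.isOpen_star e x)).continuous_lift_prod_left ?_
  refine continuous_iff_continuousAt.2 fun ⟨ξ, t⟩ => ?_
  have h := (continuousAt_mk_cellFlow e (x := x) (ξ := ξ.1) ξ.2 t).comp
    (f := fun p : (CW.mk e ⁻¹' CW.star e x) × I => (p.1.1, p.2)) (x := (ξ, t))
    (by fun_prop)
  exact h.congr (.of_forall fun p => (CW.flow_mk e p.2 p.1.2).symm)

end Stars

/-! ### Path classes of walks and of cells -/

section WalkClasses

variable {C : Type u} [Category.{v} C] [Preadditive C] (e : MorphismChoice C)

open unitInterval

/-- The homotopy class of the path described by a walk, as a morphism of the fundamental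
groupoid. -/
noncomputable def Walk.pathClass {x y : C} (p : Walk x y) :
    FundamentalGroupoid.mk (CW.vertex e x) ⟶ FundamentalGroupoid.mk (CW.vertex e y) :=
  Path.Homotopic.Quotient.mk (p.path e)

/-- The homotopy class of the path described by a virtual morphism. -/
noncomputable def VirtualHom.pathClass {x y : C} (a : VirtualHom x y) :
    FundamentalGroupoid.mk (CW.vertex e x) ⟶ FundamentalGroupoid.mk (CW.vertex e y) :=
  Path.Homotopic.Quotient.mk (a.path e)

theorem Walk.pathClass_single {x y : C} (a : VirtualHom x y) :
    (Walk.single a).pathClass e = a.pathClass e := by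
  rw [Walk.pathClass, Walk.path]
  rfl

theorem Walk.pathClass_snoc {x y z : C} (p : Walk x y) (a : VirtualHom y z) :
    (p.snoc a).pathClass e = p.pathClass e ≫ a.pathClass e := by
  rw [Walk.pathClass, Walk.path]
  rfl

theorem Walk.pathClass_append {x y z : C} (p : Walk x y) (q : Walk y z) :
    (p.append q).pathClass e = p.pathClass e ≫ q.pathClass e := by
  induction q with
  | single a => rw [Walk.append, pathClass_snoc, pathClass_single]
  | snoc q a ih => rw [Walk.append, pathClass_snoc, ih, pathClass_snoc, Category.assoc]

theorem VirtualHom.pathClass_inv {x y : C} (a : VirtualHom x y) :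
    a.inv.pathClass e = CategoryTheory.inv (a.pathClass e) := by
  rw [← Groupoid.inv_eq_inv]
  cases a with
  | fwd f hf => rfl
  | bwd f hf =>
    change Path.Homotopic.Quotient.mk _ = Path.Homotopic.Quotient.mk (Path.symm (Path.symm _))
    rw [Path.symm_symm]
    rfl

theorem Walk.pathClass_inv {x y : C} (p : Walk x y) :
    p.inv.pathClass e = CategoryTheory.inv (p.pathClass e) := by
  induction p with
  | single a =>
    rw [Walk.inv, pathClass_single, VirtualHom.pathClass_inv, pathClass_single]
  | snoc p a ih =>
    rw [Walk.inv, pathClass_append, ih, pathClass_snoc, IsIso.inv_comp, pathClass_single,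
      VirtualHom.pathClass_inv]

/-- A path class between two vertices is a walk class if it is the class of a walk. -/
def IsWalkClass {x y : C}
    (γ : FundamentalGroupoid.mk (CW.vertex e x) ⟶ FundamentalGroupoid.mk (CW.vertex e y)) : Prop :=
  ∃ p : Walk x y, p.pathClass e = γ

variable {e}

theorem IsWalkClass.comp {x y z : C}
    {γ : FundamentalGroupoid.mk (CW.vertex e x) ⟶ FundamentalGroupoid.mk (CW.vertex e y)}
    {δ : FundamentalGroupoid.mk (CW.vertex e y) ⟶ FundamentalGroupoid.mk (CW.vertex e z)}
    (hγ : IsWalkClass e γ) (hδ : IsWalkClass e δ) : IsWalkClass e (γ ≫ δ) := by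
  obtain ⟨p, rfl⟩ := hγ
  obtain ⟨q, rfl⟩ := hδ
  exact ⟨p.append q, Walk.pathClass_append e p q⟩

theorem IsWalkClass.inv {x y : C}
    {γ : FundamentalGroupoid.mk (CW.vertex e x) ⟶ FundamentalGroupoid.mk (CW.vertex e y)}
    (hγ : IsWalkClass e γ) : IsWalkClass e (CategoryTheory.inv γ) := by
  obtain ⟨p, rfl⟩ := hγ
  exact ⟨p.inv, Walk.pathClass_inv e p⟩

theorem IsWalkClass.id (hC : IsWalkConnected C) (x : C) :
    IsWalkClass e (𝟙 (FundamentalGroupoid.mk (CW.vertex e x))) := by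
  obtain ⟨p⟩ := hC x x
  rw [← IsIso.hom_inv_id (p.pathClass e)]
  exact IsWalkClass.comp ⟨p, rfl⟩ (IsWalkClass.inv ⟨p, rfl⟩)

/-- The characteristic map of a `1`-cell. -/
def OneCell.map (a : OneCell e) : C(I, CW e) where
  toFun s := CW.mk e (pt₁ e a s)
  continuous_toFun := a.path.continuous

theorem OneCell.map_zero (a : OneCell e) : a.map 0 = CW.vertex e a.src := CW.sound (Attach.src a)

theorem OneCell.map_one (a : OneCell e) : a.map 1 = CW.vertex e a.tgt := CW.sound (Attach.tgt a)

/-- The characteristic map of a `2`-cell. -/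
def TwoCell.map (c : TwoCell e) : C(Triangle, CW e) where
  toFun p := CW.mk e (pt₂ e c p)
  continuous_toFun :=
    (CW.isQuotientMap_mk e).continuous.comp (CW.isOpenEmbedding_pt₂ e c).continuous

theorem TwoCell.map_corner₀ (c : TwoCell e) : c.map (Triangle.side₀₁ 0) = CW.vertex e c.x :=
  CW.mk_corner₀ e c

theorem TwoCell.map_corner₁ (c : TwoCell e) : c.map (Triangle.side₀₁ 1) = CW.vertex e c.y :=
  CW.mk_corner₁ e c

theorem TwoCell.map_corner₂ (c : TwoCell e) : c.map (Triangle.side₁₂ 1) = CW.vertex e c.z :=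
  CW.mk_corner₂ e c

instance : ContractibleSpace I :=
  (convex_Icc 0 1).contractibleSpace ⟨0, Set.left_mem_Icc.2 zero_le_one⟩

instance : ContractibleSpace Triangle := by
  rw [contractible_iff_id_nullhomotopic]
  refine ⟨Triangle.mk 0 0, ⟨⟨⟨fun p : I × Triangle =>
    Triangle.mk ((1 - p.1) * p.2.1.1 : ℝ) ((1 - p.1) * p.2.1.2 : ℝ), ?_⟩, ?_, ?_⟩⟩⟩
  · exact Triangle.continuous_mk.comp (by fun_prop :
      Continuous fun p : I × Triangle => (((1 - p.1) * p.2.1.1 : ℝ), ((1 - p.1) * p.2.1.2 : ℝ)))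
  · intro p
    simpa using Triangle.mk_coe p
  · intro p
    simp

/-- The class of the path through a `1`-cell. -/
noncomputable def OneCell.pathClass (a : OneCell e) :
    FundamentalGroupoid.mk (CW.vertex e a.src) ⟶ FundamentalGroupoid.mk (CW.vertex e a.tgt) :=
  Path.Homotopic.Quotient.mk a.path

theorem OneCell.transport_map (a : OneCell e) :
    transport a.map 0 1 a.map_zero a.map_one = a.pathClass :=
  transport_eq_mk a.map a.map_zero a.map_one
    ⟨⟨_root_.id, continuous_id⟩, rfl, rfl⟩ a.path fun _ => rfl

theorem VirtualHom.pathClass_fwd_of_ne {x y : C} (h : x ≠ y) (f : x ⟶ y) (hf : f ≠ 0) :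
    (VirtualHom.fwd f hf).pathClass e
      = OneCell.pathClass (e := e) ⟨x, y, h, e.mor_ne_zero f hf⟩ := by
  refine congrArg Path.Homotopic.Quotient.mk ?_
  exact dif_neg h

theorem VirtualHom.pathClass_fwd_self {x : C} (f : x ⟶ x) (hf : f ≠ 0) :
    (VirtualHom.fwd f hf).pathClass e = 𝟙 _ := by
  refine congrArg Path.Homotopic.Quotient.mk (?_ : _ = Path.refl _)
  exact dif_pos rfl

theorem OneCell.isWalkClass (a : OneCell e) : IsWalkClass e a.pathClass :=
  ⟨.single (.fwd _ a.mor_ne_zero),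
    (Walk.pathClass_single e _).trans (VirtualHom.pathClass_fwd_of_ne a.ne _ _)⟩

theorem TwoCell.transport_side₀₁ (c : TwoCell e) :
    transport c.map (Triangle.side₀₁ 0) (Triangle.side₀₁ 1) c.map_corner₀
      c.map_corner₁ = c.edgeXY.pathClass := by
  rw [← OneCell.transport_map]
  exact (transport_precomp c.map
    ⟨Triangle.side₀₁, by unfold Triangle.side₀₁; fun_prop⟩ c.edgeXY.map
    (fun s => (CW.sound (Attach.sideXY c s)).symm) 0 1 _ _).symm

theorem TwoCell.transport_side₁₂ (c : TwoCell e) :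
    transport c.map (Triangle.side₁₂ 0) (Triangle.side₁₂ 1) c.map_corner₁
      c.map_corner₂ = c.edgeYZ.pathClass := by
  rw [← OneCell.transport_map]
  exact (transport_precomp c.map
    ⟨Triangle.side₁₂, by unfold Triangle.side₁₂; fun_prop⟩ c.edgeYZ.map
    (fun s => (CW.sound (Attach.sideYZ c s)).symm) 0 1 _ _).symm

theorem TwoCell.transport_side₀₂ (c : TwoCell e) :
    transport c.map (Triangle.side₀₂ 0) (Triangle.side₀₂ 1) c.map_corner₀
      c.map_corner₂ = c.edgeXY.pathClass ≫ c.edgeYZ.pathClass := by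
  rw [← c.transport_side₀₁, ← c.transport_side₁₂]
  exact (transport_comp c.map (Triangle.side₀₁ 0) (Triangle.side₀₁ 1) (Triangle.side₁₂ 1)
    _ _ _).symm

/-- The boundary of a triangular `2`-cell is null-homotopic. -/
theorem TwoCell.pathClass_comp (c : TwoCell e) (h : c.x ≠ c.z) :
    c.edgeXY.pathClass ≫ c.edgeYZ.pathClass = (c.edgeXZ h).pathClass := by
  rw [← c.transport_side₀₂, ← OneCell.transport_map]
  exact (transport_precomp c.map
    ⟨Triangle.side₀₂, by unfold Triangle.side₀₂; fun_prop⟩ (c.edgeXZ h).map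
    (fun s => (CW.sound (Attach.sideXZ c h s)).symm) 0 1 _ _).symm

/-- The boundary of a `2`-cell `x → y → x` is null-homotopic. -/
theorem TwoCell.pathClass_comp_of_eq (c : TwoCell e) (h : c.x = c.z) :
    c.edgeXY.pathClass ≫ c.edgeYZ.pathClass
      = eqToHom (congrArg (fun x => FundamentalGroupoid.mk (CW.vertex e x)) h) := by
  rw [← c.transport_side₀₂]
  obtain ⟨x, y, z, h₁, h₂, h₃, h₄, h₅, h₆⟩ := c
  obtain rfl : x = z := h
  rw [eqToHom_refl]
  refine ((transport_precomp (TwoCell.map ⟨x, y, x, h₁, h₂, h₃, h₄, h₅, h₆⟩)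
    ⟨Triangle.side₀₂, by unfold Triangle.side₀₂; fun_prop⟩ (ContinuousMap.const I (CW.vertex e x))
    (fun s => (CW.sound (Attach.sideXX ⟨x, y, x, h₁, h₂, h₃, h₄, h₅, h₆⟩ rfl s)).symm)
    0 1 rfl rfl).symm).trans ?_
  exact transport_const _ (fun _ => rfl) _ _

/-! ### Radial paths in open stars -/

/-- The path that the contraction of the open star of `x` traces from `x` to a point of the
star. -/
noncomputable def CW.radialMap {x : C} {q : CW e} (hq : q ∈ CW.star e x) : C(I, CW e) where
  toFun t := CW.flow e x t q
  continuous_toFun := (CW.continuous_flow e x).comp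
    (by fun_prop : Continuous fun t : I => ((⟨q, hq⟩ : CW.star e x), t))

/-- The class of the path that the contraction of the open star of `x` traces from `x` to a point
of the star. -/
noncomputable def CW.radial {x : C} {q : CW e} (hq : q ∈ CW.star e x) :
    FundamentalGroupoid.mk (CW.vertex e x) ⟶ FundamentalGroupoid.mk q :=
  transport (CW.radialMap hq) 0 1 (CW.flow_zero e hq) (CW.flow_one e hq)

theorem CW.radial_vertex {x : C} (h : CW.vertex e x ∈ CW.star e x) : CW.radial h = 𝟙 _ :=
  transport_const (CW.radialMap h) (CW.flow_vertex e x) 0 1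

/-- A path inside an open star is homotopic to the difference of two radial paths. -/
theorem CW.radial_comp_transport {T : Type*} [TopologicalSpace T] [ContractibleSpace T] {x : C}
    (f : C(T, CW e)) (hf : ∀ s, f s ∈ CW.star e x) {p q : CW e} (a b : T) (ha : f a = p)
    (hb : f b = q) (hp : p ∈ CW.star e x) (hq : q ∈ CW.star e x) :
    CW.radial hp ≫ transport f a b ha hb = CW.radial hq := by
  subst ha hb
  let G : C(T × I, CW e) :=
    ⟨fun s => CW.flow e x s.2 (f s.1), (CW.continuous_flow e x).comp
      (by fun_prop : Continuous fun s : T × I => ((⟨f s.1, hf s.1⟩ : CW.star e x), s.2))⟩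
  have hG0 (s : T) : G (s, 0) = CW.vertex e x := CW.flow_zero e (hf s)
  have hG1 (s : T) : G (s, 1) = f s := CW.flow_one e (hf s)
  have h₁ (s : T) : CW.radial (hf s) = transport G (s, 0) (s, 1) (hG0 s) (hG1 s) :=
    transport_precomp G ⟨fun t => (s, t), by fun_prop⟩ _ (fun t => rfl) 0 1 _ _
  have h₂ : transport f a b rfl rfl = transport G (a, 1) (b, 1) (hG1 a) (hG1 b) :=
    transport_precomp G ⟨fun s => (s, 1), by fun_prop⟩ f (fun s => (hG1 s).symm) a b rfl rfl
  have h₃ : 𝟙 _ = transport G (a, 0) (b, 0) (hG0 a) (hG0 b) :=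
    (transport_const (ContinuousMap.const T (CW.vertex e x)) (fun _ => rfl) a b).symm.trans
      (transport_precomp G ⟨fun s => (s, 0), by fun_prop⟩ _ (fun s => (hG0 s).symm) a b _ _)
  rw [h₁ a, h₁ b, h₂, transport_comp, ← Category.id_comp (transport G (b, 0) _ _ _), h₃,
    transport_comp]

theorem CW.radial_eq_transport {T : Type*} [TopologicalSpace T] [ContractibleSpace T] {x : C}
    (f : C(T, CW e)) (hf : ∀ s, f s ∈ CW.star e x) {q : CW e} (a b : T)
    (ha : f a = CW.vertex e x) (hb : f b = q) (hq : q ∈ CW.star e x) :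
    CW.radial hq = transport f a b ha hb := by
  rw [← CW.radial_comp_transport f hf a b ha hb (ha ▸ hf a) hq, CW.radial_vertex,
    Category.id_comp]

/-- The affine path from `a` to `b` in the unit interval. -/
def intervalSegment (a b : I) : C(I, I) where
  toFun s := ⟨(1 - s) * a + s * b, by
    have := mul_nonneg (sub_nonneg.2 s.2.2) a.2.1
    have := mul_nonneg s.2.1 b.2.1
    have := mul_le_mul_of_nonneg_left a.2.2 (sub_nonneg.2 s.2.2)
    have := mul_le_mul_of_nonneg_left b.2.2 s.2.1
    constructor <;> linarith⟩
  continuous_toFun := by fun_prop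

theorem intervalSegment_zero (a b : I) : intervalSegment a b 0 = a :=
  Subtype.ext (by simp [intervalSegment])

theorem intervalSegment_one (a b : I) : intervalSegment a b 1 = b :=
  Subtype.ext (by simp [intervalSegment])

theorem intervalSegment_mem_Icc {a b : I} (h : a ≤ b) (s : I) :
    intervalSegment a b s ∈ Set.Icc a b := by
  have h' : (a : ℝ) ≤ b := h
  have h₁ := mul_nonneg (sub_nonneg.2 s.2.2) (sub_nonneg.2 h')
  have h₂ := mul_nonneg s.2.1 (sub_nonneg.2 h')
  constructor
  · change (a : ℝ) ≤ (1 - s) * a + s * b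
    linarith
  · change (1 - (s : ℝ)) * a + s * b ≤ b
    linarith

theorem affine_pos {a b : ℝ} (ha : 0 < a) (hb : 0 < b) (r : I) :
    0 < (1 - (r : ℝ)) * a + r * b := by
  rcases r.2.1.eq_or_lt with h | h
  · rw [← h]; simpa using ha
  · exact add_pos_of_nonneg_of_pos (mul_nonneg (sub_nonneg.2 r.2.2) ha.le) (mul_pos h hb)

theorem OneCell.radial_eq_transport (a : OneCell e) {x : C} {k s : I}
    (hk : a.map k = CW.vertex e x) (hs : a.map s ∈ CW.star e x) :
    CW.radial hs = transport a.map k s hk rfl := by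
  have hk' : 0 < cellWeight e x (pt₁ e a k) :=
    (show a.map k ∈ CW.star e x from hk ▸ (CW.vertex_mem_star_iff e).2 rfl)
  have hs' : 0 < cellWeight e x (pt₁ e a s) := hs
  rw [CW.radial_eq_transport (a.map.comp (intervalSegment k s)) _ 0 1
    (by simp [intervalSegment_zero, hk]) (by simp [intervalSegment_one]) hs,
    transport_precomp a.map (intervalSegment k s) _ fun _ => rfl]
  · congr 1
    · exact intervalSegment_zero k s
    · exact intervalSegment_one k s
  · intro r
    change 0 < cellWeight e x (pt₁ e a (intervalSegment k s r))
    have : cellWeight e x (pt₁ e a (intervalSegment k s r))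
        = (1 - r) * cellWeight e x (pt₁ e a k) + r * cellWeight e x (pt₁ e a s) := by
      simp only [cellWeight_pt₁, intervalSegment, ContinuousMap.coe_mk]
      ring
    rw [this]
    exact affine_pos hk' hs' r

end WalkClasses

section PathClasses

variable {C : Type u} [Category.{v} C] [Preadditive C] {e : MorphismChoice C}

open unitInterval

/-- The affine path from `p` to `q` in the triangle. -/
noncomputable def Triangle.segment (p q : Triangle) : C(I, Triangle) where
  toFun s := Triangle.mk ((1 - s) * p.1.1 + s * q.1.1 : ℝ) ((1 - s) * p.1.2 + s * q.1.2 : ℝ)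
  continuous_toFun := Triangle.continuous_mk.comp (by fun_prop : Continuous fun s : I =>
    (((1 - s) * p.1.1 + s * q.1.1 : ℝ), ((1 - s) * p.1.2 + s * q.1.2 : ℝ)))

theorem Triangle.segment_zero (p q : Triangle) : Triangle.segment p q 0 = p := by
  simpa [Triangle.segment] using Triangle.mk_coe p

theorem Triangle.segment_one (p q : Triangle) : Triangle.segment p q 1 = q := by
  simpa [Triangle.segment] using Triangle.mk_coe q

theorem cellWeight_segment (x : C) (c : TwoCell e) (p q : Triangle) (r : I) :
    cellWeight e x (pt₂ e c (Triangle.segment p q r))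
      = (1 - r) * cellWeight e x (pt₂ e c p) + r * cellWeight e x (pt₂ e c q) := by
  have hp : (p.1.2 : ℝ) ≤ p.1.1 := p.2
  have hq : (q.1.2 : ℝ) ≤ q.1.1 := q.2
  have h₁ := mul_nonneg (sub_nonneg.2 r.2.2) p.1.2.2.1
  have h₂ := mul_nonneg r.2.1 q.1.2.2.1
  have h₃ := mul_le_mul_of_nonneg_left hp (sub_nonneg.2 r.2.2)
  have h₄ := mul_le_mul_of_nonneg_left hq r.2.1
  have h₅ := mul_le_mul_of_nonneg_left p.1.1.2.2 (sub_nonneg.2 r.2.2)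
  have h₆ := mul_le_mul_of_nonneg_left q.1.1.2.2 r.2.1
  have h : Triangle.segment p q r = _ :=
    Triangle.mk_eq (add_nonneg h₁ h₂) (add_le_add h₃ h₄) (by linarith)
  rw [h]
  simp only [cellWeight_pt₂]
  ring

theorem TwoCell.radial_eq_transport (c : TwoCell e) {x : C} {k p : Triangle}
    (hk : c.map k = CW.vertex e x) (hp : c.map p ∈ CW.star e x) :
    CW.radial hp = transport c.map k p hk rfl := by
  have hk' : 0 < cellWeight e x (pt₂ e c k) :=
    (show c.map k ∈ CW.star e x from hk ▸ (CW.vertex_mem_star_iff e).2 rfl)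
  rw [CW.radial_eq_transport (c.map.comp (Triangle.segment k p)) _ 0 1
    (by simp [Triangle.segment_zero, hk]) (by simp [Triangle.segment_one]) hp,
    transport_precomp c.map (Triangle.segment k p) _ fun _ => rfl]
  · congr 1
    · exact Triangle.segment_zero k p
    · exact Triangle.segment_one k p
  · intro r
    change 0 < cellWeight e x (pt₂ e c (Triangle.segment k p r))
    rw [cellWeight_segment]
    exact affine_pos hk' hp r

/-! ### Homotopy classes of paths between vertices -/

theorem OneCell.isWalkClass_transport_comp_inv_radial (hC : IsWalkConnected C) (a : OneCell e)
    (s : I) {x : C} (h : a.map s ∈ CW.star e x) :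
    IsWalkClass e (transport a.map 0 s a.map_zero rfl ≫ inv (CW.radial h)) := by
  have key (k : I) (hk : a.map k = CW.vertex e x) :
      transport a.map 0 s a.map_zero rfl ≫ inv (CW.radial h)
        = transport a.map 0 k a.map_zero hk := by
    rw [a.radial_eq_transport hk h, transport_inv, transport_comp]
  have hw : 0 < cellWeight e x (pt₁ e a s) := h
  rw [cellWeight_pt₁] at hw
  rcases delta_eq_or a.src x with ⟨rfl, -⟩ | ⟨-, hx⟩
  · rw [key 0 a.map_zero, transport_refl]
    exact .id hC _
  rcases delta_eq_or a.tgt x with ⟨rfl, -⟩ | ⟨-, hy⟩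
  · rw [key 1 a.map_one, a.transport_map]
    exact a.isWalkClass
  · simp [hx, hy] at hw

theorem TwoCell.isWalkClass_transport_comp_inv_radial (hC : IsWalkConnected C) (c : TwoCell e)
    (p : Triangle) {x : C} (h : c.map p ∈ CW.star e x) :
    IsWalkClass e (transport c.map (Triangle.side₀₁ 0) p c.map_corner₀ rfl
      ≫ inv (CW.radial h)) := by
  have key (k : Triangle) (hk : c.map k = CW.vertex e x) :
      transport c.map (Triangle.side₀₁ 0) p c.map_corner₀ rfl ≫ inv (CW.radial h)
        = transport c.map (Triangle.side₀₁ 0) k c.map_corner₀ hk := by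
    rw [c.radial_eq_transport hk h, transport_inv, transport_comp]
  have hw : 0 < cellWeight e x (pt₂ e c p) := h
  rw [cellWeight_pt₂] at hw
  rcases delta_eq_or c.x x with ⟨rfl, -⟩ | ⟨-, hx⟩
  · rw [key _ c.map_corner₀, transport_refl]
    exact .id hC _
  rcases delta_eq_or c.y x with ⟨rfl, -⟩ | ⟨-, hy⟩
  · rw [key _ c.map_corner₁, c.transport_side₀₁]
    exact c.edgeXY.isWalkClass
  rcases delta_eq_or c.z x with ⟨rfl, -⟩ | ⟨-, hz⟩
  · rw [key _ c.map_corner₂]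
    have := c.transport_side₀₂
    exact this ▸ c.edgeXY.isWalkClass.comp c.edgeYZ.isWalkClass
  · simp [hx, hy, hz] at hw

/-- Every point of the complex is joined to a vertex by a path that differs from each radial path
to the point by a walk class. -/
theorem CW.exists_isWalkClass_comp_inv_radial (hC : IsWalkConnected C) (q : CW e) :
    ∃ (b : C) (γ : FundamentalGroupoid.mk (CW.vertex e b) ⟶ FundamentalGroupoid.mk q),
      ∀ (x : C) (h : q ∈ CW.star e x), IsWalkClass e (γ ≫ inv (CW.radial h)) := by
  obtain ⟨ξ, rfl⟩ := (CW.isQuotientMap_mk e).surjective q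
  rcases ξ with ⟨y, _⟩ | ⟨a, s⟩ | ⟨c, p⟩
  · change ∃ (b : C) (γ : FundamentalGroupoid.mk (CW.vertex e b) ⟶
        FundamentalGroupoid.mk (CW.vertex e y)),
      ∀ (x : C) (h : CW.vertex e y ∈ CW.star e x), IsWalkClass e (γ ≫ inv (CW.radial h))
    refine ⟨y, 𝟙 _, fun x h => ?_⟩
    obtain rfl : y = x := (CW.vertex_mem_star_iff e).1 h
    rw [CW.radial_vertex, IsIso.inv_id, Category.comp_id]
    exact .id hC y
  · exact ⟨a.src, _, fun x h => a.isWalkClass_transport_comp_inv_radial hC s h⟩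
  · exact ⟨c.x, _, fun x h => c.isWalkClass_transport_comp_inv_radial hC p h⟩

theorem CW.isWalkClass_radial_comp_inv_radial (hC : IsWalkConnected C) {q : CW e} {x y : C}
    (hx : q ∈ CW.star e x) (hy : q ∈ CW.star e y) :
    IsWalkClass e (CW.radial hx ≫ inv (CW.radial hy)) := by
  obtain ⟨b, γ, h⟩ := CW.exists_isWalkClass_comp_inv_radial hC q
  simpa using (h x hx).inv.comp (h y hy)

theorem CW.radial_eq_transport_self (f : C(I, CW e)) (s : I) {x : C} (hs : f s = CW.vertex e x)
    (h : f s ∈ CW.star e x) : CW.radial h = transport f s s hs rfl := by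
  refine (CW.radial_eq_transport (ContinuousMap.const I (f s)) (fun _ => h) 0 1 hs rfl h).trans ?_
  exact transport_precomp f (ContinuousMap.const I s) _ (fun _ => rfl) 0 1 _ _

/-- The path `f`, restricted to the interval from `a` to `b`, becomes a walk class when it is
completed to a path between vertices by radial paths. -/
def IsWalkLike (f : C(I, CW e)) (a b : I) : Prop :=
  ∀ (x y : C) (hx : f a ∈ CW.star e x) (hy : f b ∈ CW.star e y),
    IsWalkClass e (CW.radial hx ≫ transport f a b rfl rfl ≫ inv (CW.radial hy))

theorem isWalkLike_self (hC : IsWalkConnected C) (f : C(I, CW e)) (a : I) : IsWalkLike f a a := by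
  intro x y hx hy
  rw [transport_refl, Category.id_comp]
  exact CW.isWalkClass_radial_comp_inv_radial hC hx hy

theorem IsWalkLike.extend (hC : IsWalkConnected C) {f : C(I, CW e)} {a b c : I}
    (h : IsWalkLike f a b) (hbc : b ≤ c) {z : C} (hz : ∀ s ∈ Set.Icc b c, f s ∈ CW.star e z) :
    IsWalkLike f a c := by
  intro x y hx hy
  have hz₀ : f b ∈ CW.star e z := hz b (Set.left_mem_Icc.2 hbc)
  have hz₁ : f c ∈ CW.star e z := hz c (Set.right_mem_Icc.2 hbc)
  -- The new piece runs in the star of `z`, so it is a difference of radial paths from `z`.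
  have hrad : CW.radial hz₀ ≫ transport f b c rfl rfl = CW.radial hz₁ := by
    rw [← CW.radial_comp_transport (f.comp (intervalSegment b c))
      (fun s => hz _ (intervalSegment_mem_Icc hbc s)) 0 1
      (congrArg f (intervalSegment_zero _ _)) (congrArg f (intervalSegment_one _ _)) hz₀ hz₁,
      transport_precomp f (intervalSegment b c) (f.comp (intervalSegment b c)) fun _ => rfl]
    congr 2
    · exact (intervalSegment_zero _ _).symm
    · exact (intervalSegment_one _ _).symm
  have := (h x z hx hz₀).comp (CW.isWalkClass_radial_comp_inv_radial hC hz₁ hy)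
  rw [← hrad] at this
  simpa [← transport_comp f a b c rfl rfl rfl] using this

/-- Every path between two vertices is homotopic to the path described by a walk: subdivide it
into pieces that run in open stars. -/
theorem CW.isWalkClass (hC : IsWalkConnected C) {x y : C}
    (γ : FundamentalGroupoid.mk (CW.vertex e x) ⟶ FundamentalGroupoid.mk (CW.vertex e y)) :
    IsWalkClass e γ := by
  obtain ⟨γ, rfl⟩ := Path.Homotopic.Quotient.mk_surjective γ
  obtain ⟨t, ht₀, htm, ⟨n, hn⟩, ht⟩ := exists_monotone_Icc_subset_open_cover_unitInterval
    (c := fun z => γ ⁻¹' CW.star e z) (fun z => (CW.isOpen_star e z).preimage γ.continuous)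
    fun s _ => Set.mem_iUnion.2 (CW.exists_mem_star e (γ s))
  let f : C(I, CW e) := γ.toContinuousMap
  have hf₀ : f 0 = CW.vertex e x := γ.source
  have hf₁ : f 1 = CW.vertex e y := γ.target
  have key (n : ℕ) : IsWalkLike f 0 (t n) := by
    induction n with
    | zero => rw [ht₀]; exact isWalkLike_self hC f 0
    | succ n ih =>
      obtain ⟨z, hz⟩ := ht n
      exact ih.extend hC (htm n.le_succ) fun s hs => hz hs
  have h := key n
  rw [hn n le_rfl] at h
  have h' := h x y (hf₀ ▸ (CW.vertex_mem_star_iff e).2 rfl)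
    (hf₁ ▸ (CW.vertex_mem_star_iff e).2 rfl)
  simp only [CW.radial_eq_transport_self f 0 hf₀, CW.radial_eq_transport_self f 1 hf₁,
    transport_inv, transport_comp] at h'
  rwa [transport_eq_mk f hf₀ hf₁ ⟨⟨_root_.id, continuous_id⟩, rfl, rfl⟩ γ fun _ => rfl] at h'

end PathClasses

/-! ### The covering space defined by a cocycle on the edges -/

section Covering

variable {C : Type u} [Category.{v} C] [Preadditive C] {e : MorphismChoice C}
  {Γ : Type t} [Group Γ]

open unitInterval

variable (e) in
/-- A function on pairs of objects with values in a group is a cocycle if it is trivial on the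
diagonal and multiplicative along the boundary of each `2`-cell. The order of the factors is that
of composition. -/
structure IsCocycle (d : C → C → Γ) : Prop where
  self : ∀ x, d x x = 1
  mul : ∀ c : TwoCell e, d c.y c.z * d c.x c.y = d c.x c.z

variable (e) in
/-- The first corner of the closed cell that contains the given point. -/
def cellBase : Cells e → C
  | .inl ⟨y, _⟩ => y
  | .inr (.inl ⟨a, _⟩) => a.src
  | .inr (.inr ⟨c, _⟩) => c.x

theorem cellBase_pt₀ (y : C) : cellBase e (pt₀ e y) = y := rfl

theorem cellBase_pt₁ (a : OneCell e) (s : I) : cellBase e (pt₁ e a s) = a.src := rfl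

theorem cellBase_pt₂ (c : TwoCell e) (p : Triangle) : cellBase e (pt₂ e c p) = c.x := rfl

theorem continuous_comp_cellBase {Y : Type*} [TopologicalSpace Y] (f : C → Y) :
    Continuous fun ξ => f (cellBase e ξ) :=
  continuous_sum_dom.2 ⟨continuous_sigma fun y => (continuous_const : Continuous fun _ => f y),
    continuous_sum_dom.2
      ⟨continuous_sigma fun a => (continuous_const : Continuous fun _ => f a.src),
        continuous_sigma fun c => (continuous_const : Continuous fun _ => f c.x)⟩⟩

/-- Two descriptions of the same point by closed cells give trivializations that differ by a right
translation. -/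
theorem IsCocycle.exists_cellBase_eq_mul {d : C → C → Γ} (hd : IsCocycle e d) {ξ η : Cells e}
    (h : Attach e ξ η) :
    ∃ g : Γ, ∀ x, 0 < cellWeight e x η → d (cellBase e ξ) x = d (cellBase e η) x * g := by
  cases h with
  | src a => exact ⟨1, fun x _ => (mul_one _).symm⟩
  | tgt a =>
    refine ⟨d a.src a.tgt, fun x hx => ?_⟩
    obtain rfl : a.tgt = x := (CW.vertex_mem_star_iff e).1 hx
    rw [cellBase_pt₀, hd.self, one_mul, cellBase_pt₁]
  | sideXY c s => exact ⟨1, fun x _ => (mul_one _).symm⟩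
  | sideYZ c s =>
    refine ⟨d c.x c.y, fun x hx => ?_⟩
    -- The edge starts at the second corner `c.y` of the `2`-cell, which shifts the base point.
    rw [cellBase_pt₁, cellBase_pt₂]
    change d c.x x = d c.y x * d c.x c.y
    rw [cellWeight_pt₁] at hx
    change 0 < (1 - (s : ℝ)) * delta c.y x + s * delta c.z x at hx
    rcases delta_eq_or c.y x with ⟨rfl, -⟩ | ⟨-, hy⟩
    · rw [hd.self, one_mul]
    rcases delta_eq_or c.z x with ⟨rfl, -⟩ | ⟨-, hz⟩
    · exact (hd.mul c).symm
    · simp [hy, hz] at hx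
  | sideXZ c h s => exact ⟨1, fun x _ => (mul_one _).symm⟩
  | sideXX c h s => exact ⟨1, fun x _ => (mul_one _).symm⟩

open Classical in
/-- The transition function from the star of `x` to the star of `y`, with the value `1` outside of
the intersection of the stars. -/
noncomputable def CW.transition {d : C → C → Γ} (hd : IsCocycle e d) (x y : C) : CW e → Γ :=
  Quot.lift (fun ξ => if 0 < cellWeight e x ξ ∧ 0 < cellWeight e y ξ then
    d (cellBase e ξ) y * (d (cellBase e ξ) x)⁻¹ else 1) fun ξ η h => by
      change (if _ then _ else _ : Γ) = (if _ then _ else _ : Γ)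
      simp only [cellWeight_eq_of_attach e _ h]
      split_ifs with hw
      · obtain ⟨g, hg⟩ := hd.exists_cellBase_eq_mul h
        rw [hg x hw.1, hg y hw.2]
        group
      · rfl

theorem CW.transition_mk {d : C → C → Γ} (hd : IsCocycle e d) {x y : C} {ξ : Cells e}
    (hx : CW.mk e ξ ∈ CW.star e x) (hy : CW.mk e ξ ∈ CW.star e y) :
    CW.transition hd x y (CW.mk e ξ) = d (cellBase e ξ) y * (d (cellBase e ξ) x)⁻¹ :=
  if_pos ⟨hx, hy⟩

theorem CW.continuousOn_transition [TopologicalSpace Γ] [DiscreteTopology Γ] {d : C → C → Γ}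
    (hd : IsCocycle e d) (x y : C) :
    ContinuousOn (CW.transition hd x y) (CW.star e x ∩ CW.star e y) := by
  rw [(CW.isQuotientMap_mk e).continuousOn_isOpen_iff
    ((CW.isOpen_star e x).inter (CW.isOpen_star e y))]
  exact (continuous_comp_cellBase fun z => d z y * (d z x)⁻¹).continuousOn.congr
    fun ξ hξ => CW.transition_mk hd hξ.1 hξ.2

/-- The principal bundle with discrete structure group defined by a cocycle: the group is glued
over the open stars of the vertices along left translations. -/
noncomputable def IsCocycle.bundle [TopologicalSpace Γ] [DiscreteTopology Γ] {d : C → C → Γ}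
    (hd : IsCocycle e d) : FiberBundleCore C (CW e) Γ where
  baseSet := CW.star e
  isOpen_baseSet := CW.isOpen_star e
  indexAt q := (CW.exists_mem_star e q).choose
  mem_baseSet_at q := (CW.exists_mem_star e q).choose_spec
  coordChange x y q g := CW.transition hd x y q * g
  coordChange_self x q hq g := by
    obtain ⟨ξ, rfl⟩ := (CW.isQuotientMap_mk e).surjective q
    rw [CW.transition_mk hd hq hq, mul_inv_cancel, one_mul]
  continuousOn_coordChange x y :=
    ((CW.continuousOn_transition hd x y).comp continuousOn_fst fun p hp => hp.1).mul
      continuousOn_snd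
  coordChange_comp x y z q hq g := by
    obtain ⟨ξ, rfl⟩ := (CW.isQuotientMap_mk e).surjective q
    rw [CW.transition_mk hd hq.1.1 hq.1.2, CW.transition_mk hd hq.1.2 hq.2,
      CW.transition_mk hd hq.1.1 hq.2]
    group

section Monodromy

variable [TopologicalSpace Γ] [DiscreteTopology Γ] {d : C → C → Γ}

theorem IsCocycle.isCoveringMap (hd : IsCocycle e d) : IsCoveringMap hd.bundle.proj :=
  FiberBundle.isCoveringMap

theorem IsCocycle.indexAt_vertex (hd : IsCocycle e d) (x : C) :
    hd.bundle.indexAt (CW.vertex e x) = x :=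
  ((CW.vertex_mem_star_iff e).1 (hd.bundle.mem_baseSet_at (CW.vertex e x))).symm

/-- The lift of the closed cells to the covering space, through the element `g` over the first
corner. -/
noncomputable def IsCocycle.cellLift (hd : IsCocycle e d) (g : Γ) (ξ : Cells e) :
    hd.bundle.TotalSpace :=
  ⟨CW.mk e ξ, d (cellBase e ξ) (hd.bundle.indexAt (CW.mk e ξ)) * g⟩

theorem IsCocycle.continuous_cellLift (hd : IsCocycle e d) (g : Γ) :
    Continuous (hd.cellLift g) := by
  refine continuous_iff_continuousAt.2 fun ξ => ?_
  refine (FiberBundle.continuousAt_totalSpace Γ _).2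
    ⟨(CW.isQuotientMap_mk e).continuous.continuousAt, ?_⟩
  have hmk := (CW.isQuotientMap_mk e).continuous
  set x := hd.bundle.indexAt (CW.mk e ξ) with hx
  have hξ : ξ ∈ CW.mk e ⁻¹' CW.star e x := hd.bundle.mem_baseSet_at (CW.mk e ξ)
  have hc : ContinuousAt (fun η => d (cellBase e η) x * g) ξ :=
    (continuous_comp_cellBase fun z => d z x * g).continuousAt
  refine hc.congr (Filter.eventuallyEq_of_mem
    (((CW.isOpen_star e x).preimage hmk).mem_nhds hξ) fun η hη => ?_)
  change _ = CW.transition hd (hd.bundle.indexAt (CW.mk e η)) x (CW.mk e η)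
    * (d (cellBase e η) (hd.bundle.indexAt (CW.mk e η)) * g)
  rw [CW.transition_mk hd (hd.bundle.mem_baseSet_at _) hη]
  group

/-- The point `g` of the fibre over a vertex, read in the trivialization over the star of that
vertex. -/
def IsCocycle.fiberPoint (hd : IsCocycle e d) (x : C) (g : Γ) :
    hd.bundle.proj ⁻¹' {CW.vertex e x} :=
  ⟨⟨CW.vertex e x, g⟩, rfl⟩

theorem IsCocycle.fiberPoint_injective (hd : IsCocycle e d) (x : C) :
    Function.Injective (hd.fiberPoint x) := by
  intro g h hgh
  exact eq_of_heq (Bundle.TotalSpace.mk.inj (congrArg Subtype.val hgh)).2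

theorem IsCocycle.monodromy_oneCell (hd : IsCocycle e d) (a : OneCell e) (g : Γ) :
    hd.isCoveringMap.monodromy a.pathClass (hd.fiberPoint a.src g)
      = hd.fiberPoint a.tgt (d a.src a.tgt * g) := by
  let δ : Path (hd.fiberPoint a.src g).1 (hd.fiberPoint a.tgt (d a.src a.tgt * g)).1 :=
    { toFun := fun s => hd.cellLift g (pt₁ e a s)
      continuous_toFun := (hd.continuous_cellLift g).comp (CW.isOpenEmbedding_pt₁ e a).continuous
      source' := by
        have h : CW.mk e (pt₁ e a 0) = CW.vertex e a.src := a.map_zero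
        rw [IsCocycle.cellLift, h, hd.indexAt_vertex, cellBase_pt₁, hd.self, one_mul]
        rfl
      target' := by
        have h : CW.mk e (pt₁ e a 1) = CW.vertex e a.tgt := a.map_one
        rw [IsCocycle.cellLift, h, hd.indexAt_vertex, cellBase_pt₁]
        rfl }
  exact hd.isCoveringMap.monodromy_eq_of_map_eq (Path.Homotopic.Quotient.mk δ) rfl

end Monodromy

/-- The degree of a virtual morphism for a function `d` on pairs of objects. -/
def VirtualHom.degree (d : C → C → Γ) : {x y : C} → VirtualHom x y → Γ
  | x, y, .fwd _ _ => d x y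
  | x, y, .bwd _ _ => (d y x)⁻¹

/-- The degree of a walk for a function `d` on pairs of objects. -/
def Walk.degree (d : C → C → Γ) : {x y : C} → Walk x y → Γ
  | _, _, .single a => a.degree d
  | _, _, .snoc p a => a.degree d * p.degree d

theorem VirtualHom.degree_inv (d : C → C → Γ) {x y : C} (a : VirtualHom x y) :
    a.inv.degree d = (a.degree d)⁻¹ := by
  cases a with
  | fwd f hf => rfl
  | bwd f hf => exact (inv_inv _).symm

theorem Walk.degree_append (d : C → C → Γ) {x y z : C} (p : Walk x y) (q : Walk y z) :
    (p.append q).degree d = q.degree d * p.degree d := by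
  induction q with
  | single a => simp only [Walk.append, Walk.degree]
  | snoc q a ih => simp only [Walk.append, Walk.degree, ih, mul_assoc]

theorem Walk.degree_inv (d : C → C → Γ) {x y : C} (p : Walk x y) :
    p.inv.degree d = (p.degree d)⁻¹ := by
  induction p with
  | single a => simp only [Walk.inv, Walk.degree, VirtualHom.degree_inv]
  | snoc p a ih =>
    simp only [Walk.inv, Walk.degree_append, ih, Walk.degree, VirtualHom.degree_inv, mul_inv_rev]

section WalkMonodromy

variable [TopologicalSpace Γ] [DiscreteTopology Γ] {d : C → C → Γ}

theorem IsCocycle.monodromy_fwd (hd : IsCocycle e d) {x y : C} (f : x ⟶ y) (hf : f ≠ 0) (g : Γ) :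
    hd.isCoveringMap.monodromy ((VirtualHom.fwd f hf).pathClass e) (hd.fiberPoint x g)
      = hd.fiberPoint y (d x y * g) := by
  by_cases h : x = y
  · subst h
    rw [VirtualHom.pathClass_fwd_self, hd.self, one_mul]
    exact congrFun hd.isCoveringMap.monodromy_refl _
  · rw [VirtualHom.pathClass_fwd_of_ne h]
    exact hd.monodromy_oneCell _ g

theorem IsCocycle.monodromy_virtualHom (hd : IsCocycle e d) {x y : C} (a : VirtualHom x y)
    (g : Γ) : hd.isCoveringMap.monodromy (a.pathClass e) (hd.fiberPoint x g)
      = hd.fiberPoint y (a.degree d * g) := by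
  cases a with
  | fwd f hf => exact hd.monodromy_fwd f hf g
  | bwd f hf =>
    have h := hd.monodromy_fwd f hf ((d y x)⁻¹ * g)
    rw [mul_inv_cancel_left] at h
    have h' : (VirtualHom.fwd f hf).pathClass e ≫ (VirtualHom.bwd f hf).pathClass e = 𝟙 _ := by
      rw [show (VirtualHom.bwd f hf).pathClass e = _ from
        VirtualHom.pathClass_inv e (VirtualHom.fwd f hf), IsIso.hom_inv_id]
    rw [← h, ← hd.isCoveringMap.monodromy_trans_apply]
    change hd.isCoveringMap.monodromy
      ((VirtualHom.fwd f hf).pathClass e ≫ (VirtualHom.bwd f hf).pathClass e) _ = _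
    rw [h']
    exact congrFun hd.isCoveringMap.monodromy_refl _

theorem IsCocycle.monodromy_walk (hd : IsCocycle e d) {x y : C} (p : Walk x y)
    (g : Γ) : hd.isCoveringMap.monodromy (p.pathClass e) (hd.fiberPoint x g)
      = hd.fiberPoint y (p.degree d * g) := by
  induction p with
  | single a =>
    rw [Walk.pathClass_single, Walk.degree]
    exact hd.monodromy_virtualHom a g
  | snoc p a ih =>
    rw [Walk.pathClass_snoc, Walk.degree, mul_assoc, ← hd.monodromy_virtualHom, ← ih]
    exact hd.isCoveringMap.monodromy_trans_apply _ _ _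

end WalkMonodromy

/-- Walks that describe homotopic paths have the same degree: the degree of a walk is read off from
the monodromy of the covering space defined by the cocycle. -/
theorem IsCocycle.degree_eq_of_pathClass_eq {d : C → C → Γ} (hd : IsCocycle e d) {x y : C}
    {p q : Walk x y} (h : p.pathClass e = q.pathClass e) : p.degree d = q.degree d := by
  let _ : TopologicalSpace Γ := ⊥
  have : DiscreteTopology Γ := ⟨rfl⟩
  have hp := hd.monodromy_walk p 1
  rw [h, hd.monodromy_walk q 1] at hp
  simpa using (hd.fiberPoint_injective y hp).symm

end Covering

/-! ### Gradings of Schurian categories -/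

section SchurianGradings

variable {k : Type w} [Field k] {C : Type u} [Category.{v} C] [Preadditive C] [Linear k C]
  {Γ : Type t} [Group Γ]

theorem MorphismChoice.eq_zero (e : MorphismChoice C) {x y : C} (h : e.mor x y = 0) (f : x ⟶ y) :
    f = 0 :=
  by_contra fun hf => e.mor_ne_zero f hf h

theorem IsSchurian.exists_smul_eq (hS : IsSchurian k C) {x y : C} {f : x ⟶ y} (hf : f ≠ 0)
    (g : x ⟶ y) : ∃ c : k, c • f = g := by
  rcases hS x y with h | h
  · have := rank_zero_iff.1 h
    exact (hf (Subsingleton.elim _ _)).elim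
  · exact (finrank_eq_one_iff_of_nonzero' f hf).1 (Module.rank_eq_one_iff_finrank_eq_one.1 h) g

theorem IsSchurian.mem_of_mem (hS : IsSchurian k C) {x y : C} {f : x ⟶ y} (hf : f ≠ 0)
    {A : Submodule k (x ⟶ y)} (h : f ∈ A) (g : x ⟶ y) : g ∈ A := by
  obtain ⟨c, rfl⟩ := hS.exists_smul_eq hf g
  exact A.smul_mem c h

theorem IsGrading.existsUnique_mem {X : HomFamily k C Γ} (hX : IsGrading X)
    (hS : IsSchurian k C) {x y : C} {f : x ⟶ y} (hf : f ≠ 0) : ∃! s, f ∈ X s x y := by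
  classical
  have hind := (hX.isInternal x y).submodule_iSupIndep
  have htop := (hX.isInternal x y).submodule_iSup_eq_top
  have hex : ∃ s, f ∈ X s x y := by
    by_contra! H
    have hbot : ∀ s, X s x y = ⊥ := fun s => (Submodule.eq_bot_iff _).2 fun g hg =>
      by_contra fun hg0 => H s (hS.mem_of_mem hg0 hg f)
    have : f ∈ (⨆ s, X s x y) := htop ▸ Submodule.mem_top
    simp only [hbot, iSup_bot, Submodule.mem_bot] at this
    exact hf this
  obtain ⟨s, hs⟩ := hex
  refine ⟨s, hs, fun r hr => by_contra fun hrs => hf ?_⟩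
  exact Submodule.disjoint_def.1 (hind.pairwiseDisjoint hrs) f hr hs

open Classical in
/-- The degree of the chosen morphism from `x` to `y`, if that morphism is non-zero and
homogeneous. -/
noncomputable def morDegree (X : HomFamily k C Γ) (e : MorphismChoice C) (x y : C) : Γ :=
  if h : e.mor x y ≠ 0 ∧ ∃ s, e.mor x y ∈ X s x y then h.2.choose else 1

theorem IsGrading.mem_iff {X : HomFamily k C Γ} (hX : IsGrading X) (hS : IsSchurian k C)
    (e : MorphismChoice C) {x y : C} {f : x ⟶ y} (hf : f ≠ 0) (s : Γ) :
    f ∈ X s x y ↔ s = morDegree X e x y := by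
  have hm := e.mor_ne_zero f hf
  obtain ⟨r, hr, hru⟩ := hX.existsUnique_mem hS hm
  have hd : morDegree X e x y = r := by
    rw [morDegree, dif_pos ⟨hm, r, hr⟩]
    exact hru _ (Exists.choose_spec (⟨r, hr⟩ : ∃ s, e.mor x y ∈ X s x y))
  rw [hd]
  exact ⟨fun h => hru s (hS.mem_of_mem hf h _), fun h => h ▸ hS.mem_of_mem hm hr f⟩

theorem IsGrading.isCocycle {X : HomFamily k C Γ} (hX : IsGrading X) (hS : IsSchurian k C)
    (e : MorphismChoice C) : IsCocycle e (morDegree X e) where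
  self x := by
    by_cases h : e.mor x x = 0
    · exact dif_neg fun h' => h'.1 h
    · rw [e.mor_self] at h
      have h₁ := (hX.mem_iff hS e h _).2 rfl
      have h₂ := hX.comp_mem h₁ h₁
      rw [Category.comp_id, hX.mem_iff hS e h] at h₂
      exact mul_eq_left.1 h₂
  mul c := by
    have h₁ := (hX.mem_iff hS e c.mor_xy _).2 rfl
    have h₂ := (hX.mem_iff hS e c.mor_yz _).2 rfl
    exact (hX.mem_iff hS e c.comp_ne_zero _).1 (hX.comp_mem h₁ h₂)

theorem VirtualHom.hasDegree_iff {X : HomFamily k C Γ} (hX : IsGrading X) (hS : IsSchurian k C)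
    (e : MorphismChoice C) {x y : C} (a : VirtualHom x y) (s : Γ) :
    a.HasDegree X s ↔ s = a.degree (morDegree X e) := by
  cases a with
  | fwd f hf => exact hX.mem_iff hS e hf s
  | bwd f hf => exact (hX.mem_iff hS e hf s⁻¹).trans inv_eq_iff_eq_inv

theorem Walk.hasDegree_iff {X : HomFamily k C Γ} (hX : IsGrading X) (hS : IsSchurian k C)
    (e : MorphismChoice C) {x y : C} (p : Walk x y) (s : Γ) :
    p.HasDegree X s ↔ s = p.degree (morDegree X e) := by
  induction p generalizing s with
  | single a =>
    rw [Walk.HasDegree, Walk.degree]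
    exact a.hasDegree_iff hX hS e s
  | snoc p a ih =>
    rw [Walk.HasDegree, Walk.degree]
    constructor
    · rintro ⟨r₁, r₂, h₁, h₂, rfl⟩
      rw [(ih r₁).1 h₁, (a.hasDegree_iff hX hS e r₂).1 h₂]
    · rintro rfl
      exact ⟨_, _, (ih _).2 rfl, (a.hasDegree_iff hX hS e _).2 rfl, rfl⟩

/-! ### The grading by the fundamental group -/

variable {X : HomFamily k C Γ} {c₀ : C} {e : MorphismChoice C} (W : ConnectorWalks X c₀)

variable (e) in
/-- The element of the fundamental group obtained by completing a path class between vertices to a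
loop by means of the connector walks. -/
noncomputable def ConnectorWalks.close {x y : C}
    (γ : FundamentalGroupoid.mk (CW.vertex e x) ⟶ FundamentalGroupoid.mk (CW.vertex e y)) :
    FundamentalGroup (CW e) (CW.vertex e c₀) :=
  (W.walk x).pathClass e ≫ γ ≫ inv ((W.walk y).pathClass e)

theorem ConnectorWalks.close_comp {x y z : C}
    (γ : FundamentalGroupoid.mk (CW.vertex e x) ⟶ FundamentalGroupoid.mk (CW.vertex e y))
    (δ : FundamentalGroupoid.mk (CW.vertex e y) ⟶ FundamentalGroupoid.mk (CW.vertex e z)) :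
    W.close e (γ ≫ δ) = W.close e δ * W.close e γ := by
  rw [End.mul_def]
  simp [ConnectorWalks.close]

theorem ConnectorWalks.close_id (x : C) :
    W.close e (𝟙 (FundamentalGroupoid.mk (CW.vertex e x))) = 1 := by
  rw [End.one_def]
  simp [ConnectorWalks.close]

theorem ConnectorWalks.close_inv {x y : C}
    (γ : FundamentalGroupoid.mk (CW.vertex e x) ⟶ FundamentalGroupoid.mk (CW.vertex e y)) :
    W.close e (inv γ) = (W.close e γ)⁻¹ := by
  rw [eq_inv_iff_mul_eq_one, ← W.close_comp, IsIso.hom_inv_id, W.close_id]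

theorem ConnectorWalks.pathClass_base : (W.walk c₀).pathClass e = 𝟙 _ := by
  obtain ⟨h, hw⟩ := W.walk_base
  rw [hw, Walk.pathClass_single, VirtualHom.pathClass_fwd_self]

theorem ConnectorWalks.close_base (γ : FundamentalGroup (CW e) (CW.vertex e c₀)) :
    W.close e γ = γ := by
  unfold ConnectorWalks.close
  simp only [W.pathClass_base]
  simp

theorem zDegree_eq_close {x y : C} (h : e.mor x y ≠ 0) :
    zDegree e W h = W.close e ((VirtualHom.fwd (e.mor x y) h).pathClass e) := by
  change Walk.pathClass e _ = _
  rw [Walk.pathClass_append, Walk.pathClass_append, Walk.pathClass_inv, Walk.pathClass_single,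
    Category.assoc]
  rfl

theorem zGrading_eq_top (hS : IsSchurian k C) {x y : C} (h : e.mor x y ≠ 0) :
    zGrading e W (zDegree e W h) x y = ⊤ :=
  by
  have hmem : e.mor x y ∈ zGrading e W (zDegree e W h) x y :=
    Submodule.subset_span ⟨rfl, h, rfl⟩
  exact eq_top_iff.2 fun f _ => hS.mem_of_mem h hmem f

theorem zGrading_eq_bot {x y : C} (h : e.mor x y ≠ 0)
    {r : FundamentalGroup (CW e) (CW.vertex e c₀)} (hr : r ≠ zDegree e W h) :
    zGrading e W r x y = ⊥ :=
  Submodule.span_eq_bot.2 <| by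
    rintro _ ⟨_, _, hr'⟩
    exact (hr hr'.symm).elim

theorem mem_zGrading_iff (hS : IsSchurian k C) {x y : C} {f : x ⟶ y} (hf : f ≠ 0)
    (r : FundamentalGroup (CW e) (CW.vertex e c₀)) :
    f ∈ zGrading e W r x y ↔ r = zDegree e W (e.mor_ne_zero f hf) := by
  constructor
  · intro h
    by_contra hr
    rw [zGrading_eq_bot W _ hr] at h
    exact hf ((Submodule.mem_bot k).1 h)
  · rintro rfl
    rw [zGrading_eq_top W hS]
    trivial

/-- The chosen morphisms compose in the complex as they do in the category, up to scalars: this is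
what the `2`-cells are for. -/
theorem pathClass_fwd_comp {x y z : C} {f : x ⟶ y} {g : y ⟶ z} (hS : IsSchurian k C)
    (hf : f ≠ 0) (hg : g ≠ 0) (hfg : f ≫ g ≠ 0) :
    (VirtualHom.fwd f hf).pathClass e ≫ (VirtualHom.fwd g hg).pathClass e
      = (VirtualHom.fwd (f ≫ g) hfg).pathClass e := by
  by_cases hxy : x = y
  · subst hxy
    rw [VirtualHom.pathClass_fwd_self, Category.id_comp]
    rfl
  by_cases hyz : y = z
  · subst hyz
    rw [VirtualHom.pathClass_fwd_self g, Category.comp_id]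
    rfl
  have hcomp : e.mor x y ≫ e.mor y z ≠ 0 := by
    obtain ⟨a, rfl⟩ := hS.exists_smul_eq (e.mor_ne_zero f hf) f
    obtain ⟨b, rfl⟩ := hS.exists_smul_eq (e.mor_ne_zero g hg) g
    intro h
    simp [h] at hfg
  let c : TwoCell e := ⟨x, y, z, hxy, hyz, e.mor_ne_zero f hf, e.mor_ne_zero g hg,
    e.mor_ne_zero _ hfg, hcomp⟩
  rw [VirtualHom.pathClass_fwd_of_ne hxy, VirtualHom.pathClass_fwd_of_ne hyz]
  by_cases hxz : x = z
  · subst hxz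
    rw [VirtualHom.pathClass_fwd_self]
    exact c.pathClass_comp_of_eq rfl
  · rw [VirtualHom.pathClass_fwd_of_ne hxz]
    exact c.pathClass_comp hxz

theorem isInternal_of_eq_top {ι M : Type*} [DecidableEq ι] [AddCommGroup M] [Module k M]
    {A : ι → Submodule k M} (i : ι) (hi : A i = ⊤) (h : ∀ j ≠ i, A j = ⊥) :
    DirectSum.IsInternal A := by
  refine DirectSum.isInternal_submodule_of_iSupIndep_of_iSup_eq_top (fun j => ?_)
    (eq_top_iff.2 (hi ▸ le_iSup A i))
  by_cases hj : j = i
  · subst hj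
    rw [iSup₂_eq_bot.2 h]
    exact disjoint_bot_right
  · rw [h j hj]
    exact disjoint_bot_left

theorem isGrading_zGrading (hS : IsSchurian k C) : IsGrading (zGrading e W) where
  isInternal x y := by
    classical
    by_cases h : e.mor x y = 0
    · have : Subsingleton (x ⟶ y) := ⟨fun f g => (e.eq_zero h f).trans (e.eq_zero h g).symm⟩
      exact isInternal_of_eq_top 1 (Subsingleton.elim _ _) fun _ _ => Subsingleton.elim _ _
    · exact isInternal_of_eq_top (zDegree e W h) (zGrading_eq_top W hS h)
        fun r hr => zGrading_eq_bot W h hr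
  comp_mem := by
    intro x y z s r f g hf hg
    by_cases hfg : f ≫ g = 0
    · rw [hfg]; exact Submodule.zero_mem _
    have hf0 : f ≠ 0 := fun h => hfg (by rw [h, Limits.zero_comp])
    have hg0 : g ≠ 0 := fun h => hfg (by rw [h, Limits.comp_zero])
    rw [mem_zGrading_iff W hS hf0] at hf
    rw [mem_zGrading_iff W hS hg0] at hg
    rw [mem_zGrading_iff W hS hfg, hf, hg, zDegree_eq_close, zDegree_eq_close, zDegree_eq_close,
      ← W.close_comp]
    exact congrArg (W.close e) (pathClass_fwd_comp hS hf0 hg0 hfg)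

theorem VirtualHom.hasDegree_zGrading (hS : IsSchurian k C) {x y : C} (a : VirtualHom x y) :
    a.HasDegree (zGrading e W) (W.close e (a.pathClass e)) := by
  cases a with
  | fwd f hf =>
    refine (mem_zGrading_iff W hS hf _).2 ?_
    rw [zDegree_eq_close]
    rfl
  | bwd f hf =>
    refine (mem_zGrading_iff W hS hf _).2 ?_
    rw [show (VirtualHom.bwd f hf).pathClass e = _ from
      VirtualHom.pathClass_inv e (VirtualHom.fwd f hf), W.close_inv, inv_inv, zDegree_eq_close]
    rfl

theorem Walk.hasDegree_zGrading (hS : IsSchurian k C) {x y : C} (p : Walk x y) :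
    p.HasDegree (zGrading e W) (W.close e (p.pathClass e)) := by
  induction p with
  | single a =>
    rw [Walk.HasDegree, Walk.pathClass_single]
    exact a.hasDegree_zGrading W hS
  | snoc p a ih =>
    rw [Walk.HasDegree, Walk.pathClass_snoc, W.close_comp]
    exact ⟨_, _, ih, a.hasDegree_zGrading W hS, rfl⟩

theorem isConnectedGrading_zGrading (hS : IsSchurian k C) (hC : IsWalkConnected C) :
    IsConnectedGrading (zGrading e W) := by
  intro x y r
  obtain ⟨p, hp⟩ := CW.isWalkClass hC
    (inv ((W.walk x).pathClass e) ≫ FundamentalGroup.toArrow r ≫ (W.walk y).pathClass e)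
  refine ⟨p, ?_⟩
  have h := p.hasDegree_zGrading W hS (e := e)
  have hr : W.close e (p.pathClass e) = r := by
    rw [hp]
    simp [ConnectorWalks.close]
  rwa [hr] at h

/-! ### The comparison morphism -/

/-- A group morphism with prescribed values on the degrees of the chosen morphisms is determined
on all closed walks. -/
theorem map_close_pathClass {d : C → C → Γ}
    (ψ : FundamentalGroup (CW e) (CW.vertex e c₀) →* Γ)
    (hψ : ∀ (x y : C) (h : e.mor x y ≠ 0), ψ (zDegree e W h) = d x y) {x y : C} (p : Walk x y) :
    ψ (W.close e (p.pathClass e)) = p.degree d := by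
  have hfwd {x y : C} (f : x ⟶ y) (hf : f ≠ 0) :
      ψ (W.close e ((VirtualHom.fwd f hf).pathClass e)) = d x y := by
    rw [← hψ x y (e.mor_ne_zero f hf), zDegree_eq_close]
    rfl
  have ha {x y : C} (a : VirtualHom x y) : ψ (W.close e (a.pathClass e)) = a.degree d := by
    cases a with
    | fwd f hf => exact hfwd f hf
    | bwd f hf =>
      rw [show (VirtualHom.bwd f hf).pathClass e = _ from
        VirtualHom.pathClass_inv e (VirtualHom.fwd f hf), W.close_inv, map_inv, hfwd]
      rfl
  induction p with
  | single a => rw [Walk.pathClass_single, Walk.degree, ha]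
  | snoc p a ih => rw [Walk.pathClass_snoc, W.close_comp, map_mul, ih, ha, Walk.degree]

/-- The morphism from the fundamental group defined by a cocycle: it maps the class of a closed
walk to the degree of the walk. -/
theorem IsCocycle.exists_monoidHom {d : C → C → Γ} (hd : IsCocycle e d) (hC : IsWalkConnected C)
    (c₀ : C) : ∃ φ : FundamentalGroup (CW e) (CW.vertex e c₀) →* Γ,
      ∀ p : Walk c₀ c₀, φ (p.loopClass e) = p.degree d := by
  choose q hq using fun r : FundamentalGroup (CW e) (CW.vertex e c₀) =>
    CW.isWalkClass hC (FundamentalGroup.toArrow r)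
  refine ⟨MonoidHom.mk' (fun r => (q r).degree d) fun r s => ?_, fun p => ?_⟩
  · rw [← Walk.degree_append]
    refine hd.degree_eq_of_pathClass_eq ?_
    rw [hq, Walk.pathClass_append, hq, hq]
    rfl
  · exact hd.degree_eq_of_pathClass_eq (hq _)

end SchurianGradings

end SchurianCW

theorem mainTheorem3 {k : Type w} [Field k] {C : Type u} [Category.{v} C] [Preadditive C]
    [Linear k C] (hS : SchurianCW.IsSchurian k C) (hC : SchurianCW.IsWalkConnected C)
    (e : SchurianCW.MorphismChoice C)
    {Γ : Type t} [Group Γ] (X : SchurianCW.HomFamily k C Γ)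
    (hX : SchurianCW.IsGrading X) (hXc : SchurianCW.IsConnectedGrading X)
    (c₀ : C) (W : SchurianCW.ConnectorWalks X c₀) :
    SchurianCW.IsGrading (SchurianCW.zGrading e W) ∧
    SchurianCW.IsConnectedGrading (SchurianCW.zGrading e W) ∧
    ∃ φ : FundamentalGroup (SchurianCW.CW e) (SchurianCW.CW.vertex e c₀) →* Γ,
      SchurianCW.IsQuotientVia X (SchurianCW.zGrading e W) φ ∧
      (∀ p : SchurianCW.Walk c₀ c₀, p.HasDegree X (φ (p.loopClass e))) ∧
      ∀ ψ : FundamentalGroup (SchurianCW.CW e) (SchurianCW.CW.vertex e c₀) →* Γ,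
        SchurianCW.IsQuotientVia X (SchurianCW.zGrading e W) ψ → ψ = φ := by
  classical
  have hZ := SchurianCW.isGrading_zGrading W hS (e := e)
  refine ⟨hZ, SchurianCW.isConnectedGrading_zGrading W hS hC, ?_⟩
  have hd := hX.isCocycle hS e
  obtain ⟨φ, hφ⟩ := hd.exists_monoidHom hC c₀
  -- Connector walks have degree `1`, so `φ` maps the degree of a chosen morphism for the grading
  -- by the fundamental group to its degree for `X`.
  have hφz (x y : C) (h : e.mor x y ≠ 0) :
      φ (SchurianCW.zDegree e W h) = SchurianCW.morDegree X e x y := by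
    have hW (x : C) : (W.walk x).degree (SchurianCW.morDegree X e) = 1 :=
      (((W.walk x).hasDegree_iff hX hS e 1).1 (W.hasDegree_one x)).symm
    rw [SchurianCW.zDegree, hφ, SchurianCW.Walk.degree_append, SchurianCW.Walk.degree_append,
      SchurianCW.Walk.degree_inv, hW, hW, SchurianCW.Walk.degree, SchurianCW.VirtualHom.degree]
    simp
  refine ⟨φ, ⟨fun s => ?_, fun s x y => ?_, fun s x y => ?_⟩, fun p => ?_, fun ψ hψ => ?_⟩
  · obtain ⟨p, hp⟩ := hXc c₀ c₀ s
    exact ⟨p.loopClass e, (hφ p).trans ((p.hasDegree_iff hX hS e s).1 hp).symm⟩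
  · exact (hZ.isInternal x y).submodule_iSupIndep.comp Subtype.val_injective
  · refine le_antisymm (fun f hf => ?_) (iSup_le fun r f hf => ?_)
    · by_cases h : f = 0
      · rw [h]; exact Submodule.zero_mem _
      · have hm := e.mor_ne_zero f h
        rw [hX.mem_iff hS e h] at hf
        refine Submodule.mem_iSup_of_mem ⟨SchurianCW.zDegree e W hm, ?_⟩
          ((SchurianCW.mem_zGrading_iff W hS h _).2 rfl)
        rw [hφz, hf]
    · by_cases h : f = 0
      · rw [h]; exact Submodule.zero_mem _
      · rw [SchurianCW.mem_zGrading_iff W hS h] at hf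
        rw [hX.mem_iff hS e h, ← r.2, hf, hφz]
  · exact (p.hasDegree_iff hX hS e _).2 (hφ p)
  · have hψz (x y : C) (h : e.mor x y ≠ 0) :
        ψ (SchurianCW.zDegree e W h) = SchurianCW.morDegree X e x y := by
      rw [← hX.mem_iff hS e h, hψ.eq_iSup]
      exact Submodule.mem_iSup_of_mem ⟨SchurianCW.zDegree e W h, rfl⟩
        ((SchurianCW.mem_zGrading_iff W hS h _).2 rfl)
    ext r
    obtain ⟨p, hp⟩ := SchurianCW.CW.isWalkClass hC (FundamentalGroup.toArrow r)
    have hr : r = W.close e (p.pathClass e) := by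
      rw [hp]
      exact (W.close_base r).symm
    rw [hr, SchurianCW.map_close_pathClass W ψ hψz, SchurianCW.map_close_pathClass W φ hφz]
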